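/- Let $A$ be a finite connected graph (loops and parallel edges allowed), and let $G$ and $H$ be two embeddings of $A$ on the sphere. The medial graph $G^\times$ of a plane graph $G$ is the 4-regular plane graph with one vertex on each edge of $G$ and with one edge, joining the vertices on $e$ and $e'$, for each pair of edge ends of $e$, $e'$ that are consecutive in the cyclic order around a vertex of $G$; if $G$ is a single vertex, $G^\times$ is a simple closed curve. Call $G$ unicursal if $G^\times$ is the image of a single closed curve $\gamma$ that goes straight ahead (to the opposite edge) at each vertex. For a closed curve $\gamma$ on the sphere with finitely many transverse double points (its vertices), with a chosen basepoint and orientation, let $\operatorname{sgn}(x)=+1$ if the first traversal through the vertex $x$ crosses the second from right to left and $\operatorname{sgn}(x)=-1$ otherwise, and put \[ \mathit{defect}(\gamma) = -2\sum_{\{x,y\}} \operatorname{sgn}(x)\operatorname{sgn}(y), \] the sum being over all unordered pairs of vertices that are interleaved, i.e. met in the cyclic order $x,y,x,y$ along $\gamma$. If $G$ is unicursal, then $H$ is unicursal and $\mathit{defect}(G^\times)=\mathit{defect}(H^\times)$, for every choice of basepoints and orientations of the two curves. -/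

import Mathlib

noncomputable section

/-- A multigraph is connected if it has a vertex and any two vertices are joined by a walk. -/
def Graph.IsConnected {V E : Type*} (G : Graph V E) : Prop :=
  G.vertexSet.Nonempty ∧
    ∀ x ∈ G.vertexSet, ∀ y ∈ G.vertexSet, Relation.ReflTransGen G.Adj x y

/-- A combinatorial map on an oriented surface, given on its set `D` of darts (half-edges).
`rot d` is the dart that follows `d` in counterclockwise order around the vertex of `d`;
`flip d` is the other half of the edge of `d`. -/
structure CombMap (D : Type*) where
  rot : Equiv.Perm D
  flip : Equiv.Perm D
  flip_flip : ∀ d, flip (flip d) = d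
  flip_ne : ∀ d, flip d ≠ d

namespace CombMap

variable {D : Type*}

/-- The vertices of a map are the cycles of `rot`. -/
def Vertex (M : CombMap D) : Type _ :=
  Quotient (Equiv.Perm.SameCycle.setoid M.rot)

/-- The vertex at which a dart is based. -/
def vert (M : CombMap D) (d : D) : M.Vertex :=
  Quotient.mk (Equiv.Perm.SameCycle.setoid M.rot) d

/-- The permutation that walks along the boundaries of the faces: go along `d` and, at its far end,
take the next edge in the rotation. -/
def faceStep (M : CombMap D) : Equiv.Perm D := M.rot * M.flip

/-- The faces of a map are the cycles of `faceStep`. -/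
def Face (M : CombMap D) : Type _ :=
  Quotient (Equiv.Perm.SameCycle.setoid M.faceStep)

open Classical in
/-- The number of faces. A map without darts is a single vertex on the sphere, with one face. -/
def numFaces (M : CombMap D) : ℕ :=
  if IsEmpty D then 1 else Nat.card M.Face

/-- The medial map. Its darts are `(d, true)` and `(d, false)` for the darts `d` of `M`, all based at
the medial vertex in the middle of the edge of `d`: the half-edge `(d, true)` leads into the corner
of `M` between `d` and `rot d`, and `(d, false)` leads into the corner between `rot⁻¹ d` and `d`.
So each corner `(d, rot d)` of `M` carries the medial edge with halves `(d, true)` and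
`(rot d, false)`, and the counterclockwise order around the middle of the edge of `d` is
`(d, true), (d, false), (flip d, true), (flip d, false)`. -/
def medial (M : CombMap D) : CombMap (D × Bool) where
  rot :=
    { toFun := fun
        | (d, true) => (d, false)
        | (d, false) => (M.flip d, true)
      invFun := fun
        | (d, true) => (M.flip d, false)
        | (d, false) => (d, true)
      left_inv := by rintro ⟨d, _ | _⟩ <;> simp [M.flip_flip]
      right_inv := by rintro ⟨d, _ | _⟩ <;> simp [M.flip_flip] }
  flip :=
    { toFun := fun
        | (d, true) => (M.rot d, false)
        | (d, false) => (M.rot.symm d, true)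
      invFun := fun
        | (d, true) => (M.rot d, false)
        | (d, false) => (M.rot.symm d, true)
      left_inv := by rintro ⟨d, _ | _⟩ <;> simp
      right_inv := by rintro ⟨d, _ | _⟩ <;> simp }
  flip_flip := by rintro ⟨d, _ | _⟩ <;> simp
  flip_ne := by rintro ⟨d, _ | _⟩ <;> simp

/-! The curves of a 4-regular map `M`. A closed curve is followed through its outgoing darts: leave a
vertex along `d`, reach the next vertex through `flip d`, and leave it along the opposite dart. -/

/-- One step straight ahead in a 4-regular map, from an outgoing dart to the next one. -/
def straight (M : CombMap D) : Equiv.Perm D := M.rot * M.rot * M.flip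

/-- The 4-regular map `M` is the image of a single closed curve: following a dart straight ahead, one
traverses every edge, in one of its two directions. The map without darts (the medial map of a
single vertex) counts as a simple closed curve. -/
def IsSingleCurve (M : CombMap D) : Prop :=
  ∀ b d : D, M.straight.SameCycle b d ∨ M.straight.SameCycle b (M.flip d)

/-- The `i`-th outgoing dart of the curve that starts with outgoing dart `b`. The choice of `b` is the
choice of an orientation and of a basepoint (just before the vertex of `b`). -/
def curve (M : CombMap D) (b : D) (i : ℕ) : D := M.straight^[i] b

/-- The times, within one period of the curve from `b`, at which it passes through `x`. -/
def visits (M : CombMap D) (b : D) (x : M.Vertex) : Set ℕ :=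
  {i | i < Function.minimalPeriod M.straight b ∧ M.vert (M.curve b i) = x}

/-- The time of the first traversal through `x`. -/
def firstVisit (M : CombMap D) (b : D) (x : M.Vertex) : ℕ := sInf (M.visits b x)

/-- The time of the second (and last) traversal through `x`. -/
def secondVisit (M : CombMap D) (b : D) (x : M.Vertex) : ℕ := sSup (M.visits b x)

open Classical in
/-- The sign of a vertex: `+1` if the first traversal crosses the second one from right to left, that
is, if it leaves along the dart that follows the outgoing dart of the second traversal in
counterclockwise order; `-1` otherwise. -/
def sgn (M : CombMap D) (b : D) (x : M.Vertex) : ℤ :=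
  if M.curve b (M.firstVisit b x) = M.rot (M.curve b (M.secondVisit b x)) then 1 else -1

/-- The vertices `x` and `y` are interleaved, and `x` is met first: the traversals come in the
order `x`, `y`, `x`, `y`. -/
def Interleaved (M : CombMap D) (b : D) (x y : M.Vertex) : Prop :=
  M.firstVisit b x < M.firstVisit b y ∧ M.firstVisit b y < M.secondVisit b x ∧
    M.secondVisit b x < M.secondVisit b y

/-- The defect `-2 ∑ sgn x * sgn y` of the curve with starting dart `b`, the sum being over the
interleaved pairs of vertices; each unordered pair occurs once, with `x` the vertex met first. -/
def defect (M : CombMap D) (b : D) : ℤ :=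
  -2 * ∑ᶠ (p : M.Vertex × M.Vertex) (_ : M.Interleaved b p.1 p.2), M.sgn b p.1 * M.sgn b p.2

end CombMap

/-- Swapping the two ends of every edge. -/
def swapEnds (E : Type*) : Equiv.Perm (E × Bool) where
  toFun d := (d.1, !d.2)
  invFun d := (d.1, !d.2)
  left_inv := by rintro ⟨e, _ | _⟩ <;> rfl
  right_inv := by rintro ⟨e, _ | _⟩ <;> rfl

/-- An embedding of a connected multigraph `G` (loops and parallel edges allowed) on the sphere, up
to orientation-preserving homeomorphism. The two ends of each edge `e` are named `(e, false)` and
`(e, true)`, and `base` tells at which vertex each end lies; `rot` is the counterclockwise order of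
the edge ends around the vertices. By Euler's formula the surface is the sphere. -/
structure PlanarEmbedding {V E : Type*} (G : Graph V E) where
  base : G.edgeSet × Bool → V
  isLink : ∀ e : G.edgeSet, G.IsLink e (base (e, false)) (base (e, true))
  rot : Equiv.Perm (G.edgeSet × Bool)
  sameCycle_iff : ∀ d d', rot.SameCycle d d' ↔ base d = base d'
  euler : G.vertexSet.ncard +
      CombMap.numFaces ⟨rot, swapEnds G.edgeSet, by simp [swapEnds], by simp [swapEnds]⟩ =
    G.edgeSet.ncard + 2

namespace PlanarEmbedding

variable {V E : Type*} {G : Graph V E}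

/-- The combinatorial map of an embedding. -/
def toMap (P : PlanarEmbedding G) : CombMap (G.edgeSet × Bool) :=
  ⟨P.rot, swapEnds G.edgeSet, by simp [swapEnds], by simp [swapEnds]⟩

/-- The medial graph of the plane graph `P`, a 4-regular map. -/
def medial (P : PlanarEmbedding G) : CombMap ((G.edgeSet × Bool) × Bool) :=
  P.toMap.medial

/-- A plane graph is unicursal if its medial graph is the image of a single closed curve. -/
def Unicursal (P : PlanarEmbedding G) : Prop := P.medial.IsSingleCurve

end PlanarEmbedding

end

/-! The defect is read off from a state sum. At each medial vertex the curves may cross or be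
smoothed in one of two ways, keeping or cutting the edge, so the full smoothings correspond to the
sets `S` of kept edges. For a state with `c` closed curves and `n` remaining crossings, consider
`(-2) ^ c` and the `potential` `(-2) ^ c * (2 * c + n + 3 * W)`, where `W` adds up, over the curves,
the number of self-crossings plus four times the signed count `quad` of interleaved pairs. For each
of the two quantities, the values at the three states that differ only at one vertex add up to zero
(`IsTrace.exists_smoothings`). Hence, up to the sign `(-1) ^ n`, they equal the sums over `S` of
`(-2) ^ l` and `(-2) ^ l * (2 * l)`, where `l` is the number of curves of `S` (`IsTrace.state_sum`).
In essence these are a polynomial in a loop variable and its derivative, both at `-2`.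

By Euler's formula `l` is twice the number of components of the spanning subgraph `S`, plus the
number of edges in `S`, minus the number of vertices (`stateLoops_eq`). This does not see the
embedding. The first sum therefore fixes the number of curves, hence unicursality. For a single
curve `W = n + 4 * quad`, so the second sum fixes `quad`, and the defect is `-2 * quad`
(`defect_eq`).

The relation for the potential rests on `weight_append_add_weight_append_reverse`, which compares
the two ways to join two strands, one of them with the second strand reversed. Terms with three
positions on one strand and one on the other vanish, and the rest combine to the square of the
intersection number of the strands. This number is `1` or `-1` if the strands come from two curves
crossing at the vertex, and `0` if they come from a self-crossing, because different closed curves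
have algebraic intersection number zero (`Unlinked`). That is a property of the sphere: a dimension
count with Euler's formula shows that every flow on the medial graph is a difference of heights of
its faces (`hasHeights`), and the height defined by one curve returns to its initial value along the
other. -/

/-! ### Sums over increasing tuples of positions in a list -/

section OrderedSums

variable {α β : Type*}

/-- The sum of `g` over the entries of a list. -/
def sum1 (g : α → ℤ) : List α → ℤ
  | [] => 0
  | a :: w => g a + sum1 g w

/-- The sum of `g` over the pairs of entries of a list, in the order of the list. -/
def sum2 (g : α → α → ℤ) : List α → ℤ
  | [] => 0
  | a :: w => sum1 (g a) w + sum2 g w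

/-- The sum of `g` over the triples of entries of a list, in the order of the list. -/
def sum3 (g : α → α → α → ℤ) : List α → ℤ
  | [] => 0
  | a :: w => sum2 (g a) w + sum3 g w

/-- The sum of `g` over the quadruples of entries of a list, in the order of the list. -/
def sum4 (g : α → α → α → α → ℤ) : List α → ℤ
  | [] => 0
  | a :: w => sum3 (g a) w + sum4 g w

theorem sum1_append (g : α → ℤ) (u v : List α) : sum1 g (u ++ v) = sum1 g u + sum1 g v := by
  induction u with
  | nil => simp [sum1]
  | cons a u ih => simp only [List.cons_append, sum1, ih]; ring

theorem sum1_add (g h : α → ℤ) (w : List α) :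
    sum1 (fun a => g a + h a) w = sum1 g w + sum1 h w := by
  induction w with
  | nil => simp [sum1]
  | cons a u ih => simp only [sum1, ih]; ring

theorem sum1_mul_left (c : ℤ) (g : α → ℤ) (w : List α) :
    sum1 (fun a => c * g a) w = c * sum1 g w := by
  induction w with
  | nil => simp [sum1]
  | cons a u ih => simp only [sum1, ih]; ring

theorem sum1_zero (w : List α) : sum1 (fun _ => 0) w = 0 := by
  induction w with
  | nil => rfl
  | cons a u ih => simp only [sum1, ih]; ring

theorem sum1_congr {g h : α → ℤ} {w : List α} (H : ∀ a ∈ w, g a = h a) :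
    sum1 g w = sum1 h w := by
  induction w with
  | nil => rfl
  | cons a u ih =>
    simp only [List.mem_cons, forall_eq_or_imp] at H
    simp only [sum1, ih H.2, H.1]

theorem sum2_add (g h : α → α → ℤ) (w : List α) :
    sum2 (fun a b => g a b + h a b) w = sum2 g w + sum2 h w := by
  induction w with
  | nil => simp [sum2]
  | cons a u ih => simp only [sum2, ih, sum1_add]; ring

theorem sum2_mul_left (c : ℤ) (g : α → α → ℤ) (w : List α) :
    sum2 (fun a b => c * g a b) w = c * sum2 g w := by
  induction w with
  | nil => simp [sum2]
  | cons a u ih => simp only [sum2, ih, sum1_mul_left]; ring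

theorem sum3_add (g h : α → α → α → ℤ) (w : List α) :
    sum3 (fun a b c => g a b c + h a b c) w = sum3 g w + sum3 h w := by
  induction w with
  | nil => simp [sum3]
  | cons a u ih => simp only [sum3, ih, sum2_add]; ring

theorem sum3_mul_left (c : ℤ) (g : α → α → α → ℤ) (w : List α) :
    sum3 (fun a b d => c * g a b d) w = c * sum3 g w := by
  induction w with
  | nil => simp [sum3]
  | cons a u ih => simp only [sum3, ih, sum2_mul_left]; ring

theorem sum3_zero (w : List α) : sum3 (fun _ _ _ => 0) w = 0 := by
  have := sum3_mul_left 0 (fun _ _ _ : α => 0) w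
  simpa using this

theorem sum2_congr {g h : α → α → ℤ} {w : List α} (H : ∀ a ∈ w, ∀ b ∈ w, g a b = h a b) :
    sum2 g w = sum2 h w := by
  induction w with
  | nil => rfl
  | cons a u ih =>
    simp only [sum2]
    rw [ih fun x hx y hy => H x (.tail _ hx) y (.tail _ hy),
      sum1_congr fun x hx => H a (.head _) x (.tail _ hx)]

theorem sum3_congr {g h : α → α → α → ℤ} {w : List α}
    (H : ∀ a ∈ w, ∀ b ∈ w, ∀ c ∈ w, g a b c = h a b c) : sum3 g w = sum3 h w := by
  induction w with
  | nil => rfl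
  | cons a u ih =>
    simp only [sum3]
    rw [ih fun x hx y hy z hz => H x (.tail _ hx) y (.tail _ hy) z (.tail _ hz),
      sum2_congr fun x hx y hy => H a (.head _) x (.tail _ hx) y (.tail _ hy)]

theorem sum4_congr {g h : α → α → α → α → ℤ} {w : List α}
    (H : ∀ a ∈ w, ∀ b ∈ w, ∀ c ∈ w, ∀ d ∈ w, g a b c d = h a b c d) :
    sum4 g w = sum4 h w := by
  induction w with
  | nil => rfl
  | cons a u ih =>
    simp only [sum4]
    rw [ih fun x hx y hy z hz t ht => H x (.tail _ hx) y (.tail _ hy) z (.tail _ hz) t (.tail _ ht),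
      sum3_congr fun x hx y hy z hz => H a (.head _) x (.tail _ hx) y (.tail _ hy) z (.tail _ hz)]

theorem sum2_append (g : α → α → ℤ) (u v : List α) :
    sum2 g (u ++ v) = sum2 g u + sum1 (fun a => sum1 (g a) v) u + sum2 g v := by
  induction u with
  | nil => simp [sum1, sum2]
  | cons a u ih => simp only [List.cons_append, sum1, sum2, ih, sum1_append]; ring

theorem sum3_append (g : α → α → α → ℤ) (u v : List α) :
    sum3 g (u ++ v) = sum3 g u + sum2 (fun a b => sum1 (g a b) v) u +
      sum1 (fun a => sum2 (g a) v) u + sum3 g v := by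
  induction u with
  | nil => simp [sum1, sum2, sum3]
  | cons a u ih => simp only [List.cons_append, sum1, sum2, sum3, ih, sum2_append]; ring

theorem sum4_append (g : α → α → α → α → ℤ) (u v : List α) :
    sum4 g (u ++ v) = sum4 g u + sum3 (fun a b c => sum1 (g a b c) v) u +
      sum2 (fun a b => sum2 (g a b) v) u + sum1 (fun a => sum3 (g a) v) u + sum4 g v := by
  induction u with
  | nil => simp [sum1, sum2, sum3, sum4]
  | cons a u ih => simp only [List.cons_append, sum1, sum2, sum3, sum4, ih, sum3_append]; ring

theorem sum1_reverse (g : α → ℤ) (w : List α) : sum1 g w.reverse = sum1 g w := by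
  induction w with
  | nil => rfl
  | cons a u ih => simp only [List.reverse_cons, sum1_append, sum1, ih]; ring

theorem sum2_reverse (g : α → α → ℤ) (w : List α) :
    sum2 g w.reverse = sum2 (fun a b => g b a) w := by
  induction w with
  | nil => rfl
  | cons a u ih =>
    simp only [List.reverse_cons, sum2_append, sum1, sum2, ih, sum1_reverse, add_zero]; ring

theorem sum3_reverse (g : α → α → α → ℤ) (w : List α) :
    sum3 g w.reverse = sum3 (fun a b c => g c b a) w := by
  induction w with
  | nil => rfl
  | cons a u ih =>
    simp only [List.reverse_cons, sum3_append, sum1, sum2, sum3, ih, sum1_reverse, sum2_reverse,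
      add_zero, sum1_zero]
    ring

theorem sum4_reverse (g : α → α → α → α → ℤ) (w : List α) :
    sum4 g w.reverse = sum4 (fun a b c d => g d c b a) w := by
  induction w with
  | nil => rfl
  | cons a u ih =>
    have h2 (w : List α) : sum2 (fun _ _ : α => (0 : ℤ)) w = 0 := by
      simpa using sum2_mul_left 0 (fun _ _ : α => 0) w
    simp only [List.reverse_cons, sum4_append, sum1, sum2, sum3, sum4, ih, sum1_reverse,
      sum3_reverse, add_zero, sum1_zero, h2]
    ring

theorem sum1_map (g : β → ℤ) (φ : α → β) (w : List α) :
    sum1 g (w.map φ) = sum1 (fun a => g (φ a)) w := by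
  induction w with
  | nil => rfl
  | cons a u ih => simp only [List.map_cons, sum1, ih]

theorem sum2_map (g : β → β → ℤ) (φ : α → β) (w : List α) :
    sum2 g (w.map φ) = sum2 (fun a b => g (φ a) (φ b)) w := by
  induction w with
  | nil => rfl
  | cons a u ih => simp only [List.map_cons, sum2, ih, sum1_map]

theorem sum3_map (g : β → β → β → ℤ) (φ : α → β) (w : List α) :
    sum3 g (w.map φ) = sum3 (fun a b c => g (φ a) (φ b) (φ c)) w := by
  induction w with
  | nil => rfl
  | cons a u ih => simp only [List.map_cons, sum3, ih, sum2_map]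

theorem sum4_map (g : β → β → β → β → ℤ) (φ : α → β) (w : List α) :
    sum4 g (w.map φ) = sum4 (fun a b c d => g (φ a) (φ b) (φ c) (φ d)) w := by
  induction w with
  | nil => rfl
  | cons a u ih => simp only [List.map_cons, sum4, ih, sum3_map]

theorem sum1_comm (g : α → β → ℤ) (u : List α) (v : List β) :
    sum1 (fun a => sum1 (g a) v) u = sum1 (fun b => sum1 (fun a => g a b) u) v := by
  induction u with
  | nil => simp [sum1, sum1_zero]
  | cons a u ih => simp only [sum1, ih, sum1_add]

theorem sum1_sum3_comm (g : β → α → α → α → ℤ) (u : List β) (v : List α) :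
    sum1 (fun i => sum3 (g i) v) u = sum3 (fun a b c => sum1 (fun i => g i a b c) u) v := by
  induction u with
  | nil => simp [sum1, sum3_zero]
  | cons a u ih => simp only [sum1, ih, sum3_add]

theorem sum1_mul_sum1 (g h : α → ℤ) (w : List α) :
    sum1 g w * sum1 h w =
      sum2 (fun a b => g a * h b) w + sum2 (fun a b => g b * h a) w +
        sum1 (fun a => g a * h a) w := by
  induction w with
  | nil => simp [sum1, sum2]
  | cons a u ih =>
    simp only [sum1, sum2, sum1_mul_left]
    have e : sum1 (fun b => g b * h a) u = h a * sum1 g u := by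
      rw [← sum1_mul_left]; simp only [mul_comm]
    rw [e]
    linear_combination ih

theorem sum1_insert_null (g : α → ℤ) {a : α} (h : g a = 0) (u v : List α) :
    sum1 g (u ++ a :: v) = sum1 g (u ++ v) := by
  simp [sum1_append, sum1, h]

theorem sum2_insert_null (g : α → α → ℤ) {a : α} (h1 : ∀ b, g a b = 0) (h2 : ∀ b, g b a = 0)
    (u v : List α) : sum2 g (u ++ a :: v) = sum2 g (u ++ v) := by
  induction u with
  | nil =>
    have : g a = fun _ => 0 := funext h1
    simp [sum2, this, sum1_zero]
  | cons b u ih => simp only [List.cons_append, sum2, ih, sum1_insert_null _ (h2 b)]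

theorem sum3_insert_null (g : α → α → α → ℤ) {a : α} (h1 : ∀ b c, g a b c = 0)
    (h2 : ∀ b c, g b a c = 0) (h3 : ∀ b c, g b c a = 0)
    (u v : List α) : sum3 g (u ++ a :: v) = sum3 g (u ++ v) := by
  induction u with
  | nil =>
    have h0 (w : List α) : sum2 (g a) w = 0 := by
      rw [show g a = fun b c => 0 * g a b c from by funext b c; simp [h1], sum2_mul_left]; simp
    simp [sum3, h0]
  | cons b u ih =>
    simp only [List.cons_append, sum3, ih, sum2_insert_null _ (h2 b) (h3 b)]

theorem sum4_insert_null (g : α → α → α → α → ℤ) {a : α} (h1 : ∀ b c d, g a b c d = 0)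
    (h2 : ∀ b c d, g b a c d = 0) (h3 : ∀ b c d, g b c a d = 0) (h4 : ∀ b c d, g b c d a = 0)
    (u v : List α) : sum4 g (u ++ a :: v) = sum4 g (u ++ v) := by
  induction u with
  | nil =>
    have h0 (w : List α) : sum3 (g a) w = 0 := by
      rw [show g a = fun b c d => 0 * g a b c d from by funext b c d; simp [h1], sum3_mul_left]; simp
    simp [sum4, h0]
  | cons b u ih =>
    simp only [List.cons_append, sum4, ih, sum3_insert_null _ (h2 b) (h3 b) (h4 b)]

theorem sum2_eq_zero {g : α → α → ℤ} {w : List α} (H : w.Pairwise fun a b => g a b = 0) :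
    sum2 g w = 0 := by
  induction H with
  | nil => rfl
  | @cons a w h _ ih =>
    simp only [sum2, ih]
    rw [sum1_congr h, sum1_zero]; rfl

/-- A sum over triples `i < j < k` that vanishes because, for fixed `i` and `k`, the sum over the
entries `j` between them does. -/
theorem sum3_eq_zero_of_between {e : α → α → ℤ} {g : α → ℤ} (w : List α)
    (H : ∀ w₁ i w₂ k w₃, w = w₁ ++ i :: w₂ ++ k :: w₃ → e i k ≠ 0 → sum1 g w₂ = 0) :
    sum3 (fun i j k => e i k * g j) w = 0 := by
  induction w with
  | nil => rfl
  | cons i w ih =>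
    simp only [sum3]
    rw [ih fun w₁ i' w₂ k w₃ h => H (i :: w₁) i' w₂ k w₃ (by simp [h]), add_zero]
    have H' : ∀ w₂ k w₃, w = w₂ ++ k :: w₃ → e i k ≠ 0 → sum1 g w₂ = 0 := fun w₂ k w₃ h =>
      H [] i w₂ k w₃ (by simp [h])
    clear H ih
    -- Peeling from the end makes `k` the last entry, so that all of the remaining `w` lies between
    -- `i` and `k`.
    induction w using List.reverseRecOn with
    | nil => rfl
    | append_singleton w k ih =>
      rw [sum2_append, ih fun w₂ k' w₃ h => H' w₂ k' (w₃ ++ [k]) (by simp [h])]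
      simp only [sum1, sum2, add_zero, zero_add, sum1_mul_left]
      by_cases h : e i k = 0
      · simp [h]
      · simp [H' w k [] rfl h]

/-- A sum over triples `j < k < l` that vanishes because, for fixed `k`, the sum over the pairs
`j`, `l` on its two sides does. -/
theorem sum3_eq_zero_of_sides {c : α → ℤ} {e : α → α → ℤ} (w : List α)
    (H : ∀ w₁ k w₂, w = w₁ ++ k :: w₂ → c k ≠ 0 → sum1 (fun j => sum1 (e j) w₂) w₁ = 0) :
    sum3 (fun j k l => c k * e j l) w = 0 := by
  -- The generalization counts the triples of `pre ++ w` whose middle entry lies in `w`. The entries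
  -- already passed accumulate in `pre`.
  have key : ∀ w pre : List α,
      (∀ w₁ k w₂, w = w₁ ++ k :: w₂ → c k ≠ 0 → sum1 (fun j => sum1 (e j) w₂) (pre ++ w₁) = 0) →
      sum2 (fun k l => c k * sum1 (fun j => e j l) pre) w +
        sum3 (fun j k l => c k * e j l) w = 0 := by
    intro w
    induction w with
    | nil => intro pre _; rfl
    | cons b w ih =>
      intro pre H
      have h1 := ih (pre ++ [b]) fun w₁ k w₂ h hk => by
        simpa using H (b :: w₁) k w₂ (by simp [h]) hk
      have h2 : c b * sum1 (fun j => sum1 (e j) w) pre = 0 := by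
        by_cases hb : c b = 0
        · simp [hb]
        · rw [show sum1 (fun j => sum1 (e j) w) pre = 0 by simpa using H [] b w rfl hb]; simp
      rw [sum1_comm] at h2
      simp only [sum1_append, sum1, mul_add, sum2_add, add_zero] at h1
      simp only [sum2, sum3, sum1_mul_left] at h1 ⊢
      linear_combination h1 + h2
  have := key w [] (by simpa using H)
  have h0 : sum2 (fun k l => c k * sum1 (fun j => e j l) []) w = 0 := by
    refine sum2_eq_zero ?_
    simp only [sum1, mul_zero]
    exact List.pairwise_of_forall fun _ _ => trivial
  simpa [h0] using this

end OrderedSums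

/-! ### The weight of a list with respect to an antisymmetric form -/

section Weight

variable {α : Type*}

/-- The sum of `E i k * E j l` over the positions `i < j < k < l` of a list. -/
def quad (E : α → α → ℤ) (w : List α) : ℤ := sum4 (fun i j k l => E i k * E j l) w

/-- The number of related pairs of positions plus four times `quad`. -/
def weight (E : α → α → ℤ) (w : List α) : ℤ := sum2 (fun a b => E a b ^ 2) w + 4 * quad E w

/-- The sum of a form over the pairs with one entry in each of two lists. -/
def cross (E : α → α → ℤ) (u v : List α) : ℤ := sum1 (fun a => sum1 (E a) v) u

variable {E : α → α → ℤ}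

theorem cross_congr {E' : α → α → ℤ} {u v : List α} (h : ∀ a ∈ u, ∀ b ∈ v, E a b = E' a b) :
    cross E u v = cross E' u v :=
  sum1_congr fun a ha => sum1_congr fun b hb => h a ha b hb

theorem quad_congr {E' : α → α → ℤ} {w : List α} (h : ∀ a ∈ w, ∀ b ∈ w, E a b = E' a b) :
    quad E w = quad E' w :=
  sum4_congr fun a ha b hb c hc d hd => by rw [h a ha c hc, h b hb d hd]

theorem weight_congr {E' : α → α → ℤ} {w : List α} (h : ∀ a ∈ w, ∀ b ∈ w, E a b = E' a b) :
    weight E w = weight E' w := by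
  unfold weight
  rw [quad_congr h, sum2_congr fun a ha b hb => by rw [h a ha b hb]]

theorem quad_insert_null (hE : ∀ a b, E b a = -E a b) {a : α} (ha : ∀ b, E a b = 0)
    (u v : List α) : quad E (u ++ a :: v) = quad E (u ++ v) := by
  have ha' : ∀ b, E b a = 0 := fun b => by rw [hE, ha, neg_zero]
  exact sum4_insert_null _ (by simp [ha]) (by simp [ha]) (by simp [ha']) (by simp [ha']) u v

/-- A visit of a smoothed vertex pairs to zero with every visit; this removes it from the weight. -/
theorem weight_insert_null (hE : ∀ a b, E b a = -E a b) {a : α} (ha : ∀ b, E a b = 0)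
    (u v : List α) : weight E (u ++ a :: v) = weight E (u ++ v) := by
  have ha' : ∀ b, E b a = 0 := fun b => by rw [hE, ha, neg_zero]
  unfold weight
  rw [quad_insert_null hE ha, sum2_insert_null _ (by simp [ha]) (by simp [ha'])]

/-- Moving a first entry that separates the list into unlinked parts does not change `quad`. -/
theorem quad_cons (a : α) (w : List α)
    (H : ∀ w₁ k w₂, w = w₁ ++ k :: w₂ → E a k ≠ 0 → cross E w₁ w₂ = 0) :
    quad E (a :: w) = quad E w := by
  unfold quad
  rw [sum4, sum3_eq_zero_of_sides w H, zero_add]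

/-- A quadruple that ends in `a` pairs `a` with some `j`, and its other pair has one entry on each
side of `j`. Up to sign, these terms are again `E a j` times a vanishing cross sum. -/
theorem quad_concat (hE : ∀ a b, E b a = -E a b) (a : α) (w : List α)
    (H : ∀ w₁ k w₂, w = w₁ ++ k :: w₂ → E a k ≠ 0 → cross E w₁ w₂ = 0) :
    quad E (w ++ [a]) = quad E w := by
  unfold quad
  rw [sum4_append]
  have h2 : sum2 (fun _ _ : α => (0 : ℤ)) w = 0 := by
    simpa using sum2_mul_left 0 (fun _ _ : α => 0) w
  have h3 : sum3 (fun i j k => E i k * E j a) w = 0 := by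
    have := sum3_mul_left (-1) (fun j k l => E a k * E j l) w
    rw [sum3_eq_zero_of_sides w H] at this
    rw [← mul_zero (-1), ← this]
    congr 1
    funext i j k
    rw [hE a j]; ring
  simp [sum1, sum2, sum3, sum4, sum1_zero, h2, h3]

/-- This moves the basepoint past one visit: `quad` ignores the visit `a` at either end, and the
squares are symmetric. -/
theorem weight_rotate_one (hE : ∀ a b, E b a = -E a b) (a : α) (w : List α)
    (H : ∀ w₁ k w₂, w = w₁ ++ k :: w₂ → E a k ≠ 0 → cross E w₁ w₂ = 0) :
    weight E (w ++ [a]) = weight E (a :: w) := by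
  unfold weight
  rw [quad_cons a w H, quad_concat hE a w H, sum2_append]
  simp only [sum1, sum2, add_zero]
  rw [sum1_congr fun b _ => show E b a ^ 2 = E a b ^ 2 by rw [hE a b]; ring]
  ring

/-- Joining two strands in the two possible ways. -/
theorem weight_append_add_weight_append_reverse (hE : ∀ a b, E b a = -E a b) {ν : α → α}
    (hν : ∀ a b, E (ν a) b = -E a b) (u v : List α)
    (hu : u.Pairwise fun a b => ∀ c ∈ v, E a c * E b c = 0)
    (hv : v.Pairwise fun a b => ∀ c ∈ u, E c a * E c b = 0)
    (huv : sum3 (fun i j k => E i k * sum1 (E j) v) u = 0)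
    (hvu : sum3 (fun i j k => E i k * sum1 (E j) u) v = 0) :
    weight E (u ++ v) + weight E (u ++ (v.map ν).reverse) =
      2 * (weight E u + weight E v) + 2 * cross E u v ^ 2 := by
  have hν' : ∀ a b, E b (ν a) = -E b a := fun a b => by rw [hE (ν a), hν, hE a b]
  have hνν : ∀ a b, E (ν a) (ν b) = E a b := fun a b => by rw [hν, hν', neg_neg]
  -- This is `hvu` written with the single position in front, as it occurs when a quadruple is split
  -- between `u` and `v`.
  have hvu' : sum1 (fun i => sum3 (fun j k l => E i k * E j l) v) u = 0 := by
    rw [sum1_sum3_comm]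
    have := sum3_mul_left (-1) (fun i j k => E i k * sum1 (E j) u) v
    rw [hvu] at this
    rw [← mul_zero (-1), ← this]
    congr 1
    funext j k l
    rw [← mul_assoc, ← sum1_mul_left]
    exact sum1_congr fun i _ => by rw [hE i k]; ring
  -- A quadruple meets `u` and `v` in 4+0, 3+1, 2+2, 1+3 or 0+4 positions; `huv` and `hvu'` kill the
  -- cases 3+1 and 1+3.
  have e1 : quad E (u ++ v) =
      quad E u + sum2 (fun i j => sum2 (fun k l => E i k * E j l) v) u + quad E v := by
    unfold quad
    rw [sum4_append, hvu']
    simp only [sum1_mul_left]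
    rw [huv]; ring
  -- In the case 2+2 the two signs from `ν` cancel, and only the order of the two positions in `v`
  -- is exchanged.
  have e2 : quad E (u ++ (v.map ν).reverse) =
      quad E u + sum2 (fun i j => sum2 (fun k l => E i l * E j k) v) u + quad E v := by
    unfold quad
    rw [sum4_append]
    simp only [sum1_mul_left, sum1_reverse, sum2_reverse, sum3_reverse, sum4_reverse, sum1_map,
      sum2_map, sum3_map, sum4_map, hνν, hν']
    have a1 : sum3 (fun i j k => E i k * sum1 (fun l => -E j l) v) u = 0 := by
      have := sum3_mul_left (-1) (fun i j k => E i k * sum1 (E j) v) u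
      rw [huv] at this
      rw [← mul_zero (-1), ← this]
      congr 1
      funext i j k
      rw [show (fun l => -E j l) = fun l => -1 * E j l by funext l; ring, sum1_mul_left]; ring
    have a2 : sum1 (fun i => sum3 (fun j k l => -E i k * E l j) v) u = 0 := by
      rw [← hvu']
      congr 1
      funext i
      congr 1
      funext j k l
      rw [hE j l]; ring
    have a3 : sum4 (fun a b c d => E d b * E c a) v = sum4 (fun i j k l => E i k * E j l) v := by
      congr 1
      funext a b c d
      rw [hE b d, hE a c]; ring
    have a4 : (fun i j => sum2 (fun a b => -E i b * -E j a) v) =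
        fun i j => sum2 (fun k l => E i l * E j k) v := by
      funext i j
      congr 1
      funext a b
      ring
    rw [a1, a2, a3, a4]; ring
  -- Both orders of `k` and `l` together give the product of two sums over `v`; its diagonal
  -- vanishes since no entry of `v` pairs with two entries of `u`.
  have e3 : sum2 (fun i j => sum2 (fun k l => E i k * E j l) v) u +
      sum2 (fun i j => sum2 (fun k l => E i l * E j k) v) u =
      sum2 (fun i j => sum1 (E i) v * sum1 (E j) v) u := by
    have h : sum2 (fun i j => sum1 (fun k => E i k * E j k) v) u = 0 :=
      sum2_eq_zero (hu.imp fun h => by rw [sum1_congr h, sum1_zero])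
    simp only [sum1_mul_sum1, sum2_add, h]; ring
  -- Expanding the square leaves the off-diagonal products of `e3` and, as no entry of `u` pairs
  -- with two entries of `v`, the squares `E i k ^ 2`, which are the crossings between the strands.
  have e4 : cross E u v ^ 2 = 2 * sum2 (fun i j => sum1 (E i) v * sum1 (E j) v) u +
      sum1 (fun i => sum1 (fun k => E i k ^ 2) v) u := by
    have h : sum1 (fun i => sum1 (E i) v * sum1 (E i) v) u =
        sum1 (fun i => sum1 (fun k => E i k ^ 2) v) u := by
      refine sum1_congr fun i hi => ?_
      rw [sum1_mul_sum1, sum2_eq_zero (hv.imp fun h => h i hi),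
        sum2_eq_zero (hv.imp fun h => by rw [mul_comm]; exact h i hi)]
      simp only [sq, zero_add]
    unfold cross
    rw [sq, sum1_mul_sum1, h]
    have h2 : sum2 (fun i j => sum1 (E j) v * sum1 (E i) v) u =
        sum2 (fun i j => sum1 (E i) v * sum1 (E j) v) u := by simp only [mul_comm]
    rw [h2]; ring
  have e5 : sum2 (fun a b => E a b ^ 2) (u ++ (v.map ν).reverse) =
      sum2 (fun a b => E a b ^ 2) u + sum1 (fun i => sum1 (fun k => E i k ^ 2) v) u +
        sum2 (fun a b => E a b ^ 2) v := by
    rw [sum2_append]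
    simp only [sum1_reverse, sum2_reverse, sum1_map, sum2_map, hνν, hν', neg_sq]
    rw [show (fun a b => E b a ^ 2) = fun a b => E a b ^ 2 by funext a b; rw [hE a b]; ring]
  unfold weight
  rw [e1, e2, e5, sum2_append]
  linear_combination 4 * e3 - 2 * e4

end Weight

/-! ### Smoothing states of a medial graph and their closed curves

The darts of the medial graph are `((e, s), t)`: the darts `(e, true, true)`, `(e, true, false)`,
`(e, false, true)`, `(e, false, false)` surround the medial vertex on `e` in this cyclic order.
In the *state* `σ`, the curves cross at `e` if `σ e = none`, and the crossing is smoothed in one of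
the two ways if `σ e = some b`: the curves avoid the edge `e` if `b = true` and cut it if
`b = false`. -/

/-- The darts of the medial graph of a graph with edge set `X`. -/
abbrev MedialDart (X : Type*) := (X × Bool) × Bool

section States

variable {X : Type*}

/-- The dart that is joined to a dart at its vertex, for each of the three matchings. -/
def mateOf (τ : Option Bool) (d : MedialDart X) : MedialDart X :=
  match τ with
  | none => ((d.1.1, !d.1.2), d.2)
  | some false => (d.1, !d.2)
  | some true => ((d.1.1, !d.1.2), !d.2)

/-- The dart that is joined to a dart at its vertex in a state. -/
def mate (σ : X → Option Bool) (d : MedialDart X) : MedialDart X := mateOf (σ d.1.1) d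

@[simp] theorem mateOf_mateOf (τ : Option Bool) (d : MedialDart X) :
    mateOf τ (mateOf τ d) = d := by
  rcases d with ⟨⟨e, s⟩, t⟩
  rcases τ with _ | _ | _ <;> simp [mateOf]

theorem mateOf_ne (τ : Option Bool) (d : MedialDart X) : mateOf τ d ≠ d := by
  rcases d with ⟨⟨e, s⟩, t⟩
  rcases τ with _ | _ | _ <;> simp [mateOf]

@[simp] theorem mateOf_fst_fst (τ : Option Bool) (d : MedialDart X) :
    (mateOf τ d).1.1 = d.1.1 := by
  rcases τ with _ | _ | _ <;> simp [mateOf]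

@[simp] theorem mate_fst_fst (σ : X → Option Bool) (d : MedialDart X) :
    (mate σ d).1.1 = d.1.1 := mateOf_fst_fst _ _

@[simp] theorem mate_mate (σ : X → Option Bool) (d : MedialDart X) : mate σ (mate σ d) = d := by
  simp [mate]

theorem mate_ne (σ : X → Option Bool) (d : MedialDart X) : mate σ d ≠ d := mateOf_ne _ _

theorem mate_congr {σ σ' : X → Option Bool} {d : MedialDart X} (h : σ d.1.1 = σ' d.1.1) :
    mate σ d = mate σ' d := by simp [mate, h]

theorem exists_mateOf_eq {a b : MedialDart X} (h : a.1.1 = b.1.1) (hne : b ≠ a) :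
    ∃ τ, b = mateOf τ a := by
  rcases a with ⟨⟨e, s⟩, t⟩
  rcases b with ⟨⟨e', s'⟩, t'⟩
  obtain rfl : e = e' := h
  by_cases hs : s = s' <;> by_cases ht : t = t'
  · simp [hs, ht] at hne
  · exact ⟨some false, by simp [mateOf, hs, Bool.eq_not.2 (Ne.symm ht)]⟩
  · exact ⟨none, by simp [mateOf, ht, Bool.eq_not.2 (Ne.symm hs)]⟩
  · exact ⟨some true, by simp [mateOf, Bool.eq_not.2 (Ne.symm ht), Bool.eq_not.2 (Ne.symm hs)]⟩

theorem mateOf_left_injective (a : MedialDart X) :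
    Function.Injective fun τ : Option Bool => mateOf τ a := by
  rcases a with ⟨⟨e, s⟩, t⟩
  intro τ τ' h
  rcases τ with _ | _ | _ <;> rcases τ' with _ | _ | _ <;> first | rfl | simp [mateOf] at h

/-- The three matchings of the four darts at a vertex, with the identity, form a Klein four-group,
so each is the product of the other two. -/
theorem exists_third_mateOf {τ τ' : Option Bool} (h : τ ≠ τ') :
    ∃ τ'' : Option Bool, τ'' ≠ τ ∧ τ'' ≠ τ' ∧ ∀ a : MedialDart X,
      mateOf τ'' (mateOf τ a) = mateOf τ' a ∧ mateOf τ'' (mateOf τ' a) = mateOf τ a := by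
  rcases τ with _ | _ | _ <;> rcases τ' with _ | _ | _
  · exact absurd rfl h
  · exact ⟨some true, by simp [mateOf]⟩
  · exact ⟨some false, by simp [mateOf]⟩
  · exact ⟨some true, by simp [mateOf]⟩
  · exact absurd rfl h
  · exact ⟨none, by simp [mateOf]⟩
  · exact ⟨some false, by simp [mateOf]⟩
  · exact ⟨none, by simp [mateOf]⟩
  · exact absurd rfl h

theorem mateOf_comm (τ τ' : Option Bool) (a : MedialDart X) :
    mateOf τ (mateOf τ' a) = mateOf τ' (mateOf τ a) := by
  rcases τ with _ | _ | _ <;> rcases τ' with _ | _ | _ <;> simp [mateOf]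

theorem eq_or_eq_of_two_matched_pairs (τ : Option Bool) {p q d : MedialDart X}
    (hpq : p.1.1 = q.1.1) (hd : d.1.1 = p.1.1) (h1 : q ≠ p) (h2 : q ≠ mateOf τ p) :
    d = p ∨ d = mateOf τ p ∨ d = q ∨ d = mateOf τ q := by
  rcases p with ⟨⟨e, s⟩, t⟩
  rcases q with ⟨⟨e', s'⟩, t'⟩
  rcases d with ⟨⟨e'', s''⟩, t''⟩
  obtain rfl : e = e' := hpq
  obtain rfl : e'' = e := hd
  rcases τ with _ | _ | _ <;> cases s <;> cases t <;> cases s' <;> cases t' <;> cases s'' <;>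
    cases t'' <;> simp_all [mateOf]

/-- `IsWalk f σ p w z`: starting along the dart `p`, the curve of the state `σ` leaves the next
vertices along the darts in `w` and then arrives at a vertex through the dart `z`. Here `f`
exchanges the two halves of each medial edge. -/
def IsWalk (f : MedialDart X → MedialDart X) (σ : X → Option Bool) :
    MedialDart X → List (MedialDart X) → MedialDart X → Prop
  | p, [], z => f p = z
  | p, b :: w, z => b = mate σ (f p) ∧ IsWalk f σ b w z

/-- A nonempty cyclic list of darts along which a closed curve of the state `σ` leaves the vertices
that it visits. -/
def IsClosedWalk (f : MedialDart X → MedialDart X) (σ : X → Option Bool) :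
    List (MedialDart X) → Prop
  | [] => False
  | p :: w => ∃ z, IsWalk f σ p w z ∧ p = mate σ z

/-- A list of darts with exactly one half of each medial edge. -/
structure IsHalf (f : MedialDart X → MedialDart X) (l : List (MedialDart X)) : Prop where
  nodup : l.Nodup
  mem_or : ∀ d, d ∈ l ∨ f d ∈ l
  not_mem : ∀ d ∈ l, f d ∉ l

/-- A list of the closed curves of the state `σ`, each with a direction and a starting point. -/
structure IsTrace (f : MedialDart X → MedialDart X) (σ : X → Option Bool)
    (D : List (List (MedialDart X))) : Prop where
  closed : ∀ w ∈ D, IsClosedWalk f σ w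
  half : IsHalf f D.flatten

variable {f : MedialDart X → MedialDart X} {σ σ' : X → Option Bool}

theorem isWalk_append {p q z : MedialDart X} {u v : List (MedialDart X)} :
    IsWalk f σ p (u ++ q :: v) z ↔ ∃ y, IsWalk f σ p u y ∧ q = mate σ y ∧ IsWalk f σ q v z := by
  induction u generalizing p with
  | nil => simp [IsWalk]
  | cons b u ih => simp [IsWalk, ih, and_assoc]

/-- Walked backwards, a curve leaves each vertex along the dart through which it used to arrive, the
mate of its former outgoing dart. -/
theorem IsWalk.reverse (hf : ∀ d, f (f d) = d) {p z : MedialDart X} {w : List (MedialDart X)}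
    (h : IsWalk f σ p w z) : IsWalk f σ z (w.map (mate σ)).reverse p := by
  induction w generalizing p with
  | nil => rw [← show f p = z from h]; exact hf p
  | cons b w ih =>
    obtain ⟨hb, h⟩ := h
    simp only [List.map_cons, List.reverse_cons]
    exact isWalk_append.2 ⟨b, ih h, rfl, by simp [IsWalk, hb, hf]⟩

/-- Reversing a strand exchanges each of its outgoing darts for the other half of the same medial
edge, which keeps a trace a choice of one half per edge. -/
theorem IsWalk.reverse_perm {p z : MedialDart X} {w : List (MedialDart X)}
    (h : IsWalk f σ p w z) : (z :: (w.map (mate σ)).reverse).Perm ((p :: w).map f) := by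
  refine ((List.reverse_perm _).cons z).trans ?_
  induction w generalizing p with
  | nil => rw [← show f p = z from h]; simp
  | cons b w ih =>
    obtain ⟨hb, h⟩ := h
    have e : mate σ b = f p := by simp [hb]
    rw [List.map_cons, List.map_cons, e]
    exact (List.Perm.swap _ _ _).trans ((ih h).cons _)

theorem IsWalk.congr {p z : MedialDart X} {w : List (MedialDart X)} (h : IsWalk f σ p w z)
    (hw : ∀ b ∈ w, σ b.1.1 = σ' b.1.1) : IsWalk f σ' p w z := by
  induction w generalizing p with
  | nil => exact h
  | cons b w ih =>
    obtain ⟨hb, h⟩ := h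
    refine ⟨?_, ih h fun b hb => hw b (.tail _ hb)⟩
    rw [hb]
    refine mate_congr ?_
    have := hw b (.head _)
    rwa [hb, mate_fst_fst] at this

theorem IsClosedWalk.congr {w : List (MedialDart X)} (h : IsClosedWalk f σ w)
    (hw : ∀ b ∈ w, σ b.1.1 = σ' b.1.1) : IsClosedWalk f σ' w := by
  cases w with
  | nil => exact h
  | cons p w =>
    obtain ⟨z, h, hz⟩ := h
    refine ⟨z, h.congr fun b hb => hw b (.tail _ hb), ?_⟩
    rw [hz]
    refine mate_congr ?_
    have := hw p (.head _)
    rwa [hz, mate_fst_fst] at this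

theorem IsClosedWalk.rotate {u v : List (MedialDart X)} (h : IsClosedWalk f σ (u ++ v)) :
    IsClosedWalk f σ (v ++ u) := by
  cases u with
  | nil => simpa using h
  | cons p u =>
    cases v with
    | nil => simpa using h
    | cons q v =>
      obtain ⟨z, h, hz⟩ := h
      obtain ⟨y, h1, h2, h3⟩ := isWalk_append.1 h
      exact ⟨y, isWalk_append.2 ⟨z, h3, hz, h1⟩, h2⟩

theorem IsWalk.exists_eq {p z : MedialDart X} {w : List (MedialDart X)} (h : IsWalk f σ p w z) :
    ∃ a ∈ p :: w, f a = z := by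
  induction w generalizing p with
  | nil => exact ⟨p, by simp, h⟩
  | cons b w ih =>
    obtain ⟨a, ha, h⟩ := ih h.2
    exact ⟨a, .tail _ ha, h⟩

theorem IsClosedWalk.exists_pred {w : List (MedialDart X)} (h : IsClosedWalk f σ w)
    {d : MedialDart X} (hd : d ∈ w) : ∃ a ∈ w, d = mate σ (f a) := by
  obtain ⟨u, v, rfl⟩ := List.append_of_mem hd
  obtain ⟨z, h1, h2⟩ := h.rotate
  obtain ⟨a, ha, rfl⟩ := h1.exists_eq
  have ha : a ∈ d :: (v ++ u) := ha
  exact ⟨a, by grind, h2⟩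

theorem IsClosedWalk.succ_mem {w : List (MedialDart X)} (h : IsClosedWalk f σ w)
    {d : MedialDart X} (hd : d ∈ w) : mate σ (f d) ∈ w := by
  obtain ⟨u, v, rfl⟩ := List.append_of_mem hd
  obtain ⟨z, h1, h2⟩ := h.rotate
  have h1' : IsWalk f σ d (v ++ u) z := h1
  cases hvu : v ++ u with
  | nil =>
    rw [hvu] at h1'
    rw [show f d = z from h1', ← h2]; simp
  | cons b t =>
    rw [hvu] at h1'
    have : b ∈ v ++ u := by rw [hvu]; simp
    rw [← h1'.1]
    grind

theorem IsHalf.perm {l l' : List (MedialDart X)} (h : IsHalf f l) (hl : l.Perm l') :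
    IsHalf f l' :=
  ⟨hl.nodup_iff.1 h.nodup, fun d => by simpa [hl.mem_iff] using h.mem_or d,
    fun d hd => by simpa [hl.mem_iff] using h.not_mem d (hl.mem_iff.2 hd)⟩

theorem IsHalf.flip_part (hf : ∀ d, f (f d) = d) {u v w : List (MedialDart X)}
    (h : IsHalf f (u ++ v ++ w)) : IsHalf f (u ++ v.map f ++ w) := by
  have hfi : Function.Injective f := fun a b hab => by rw [← hf a, hab, hf]
  obtain ⟨h1, h2, h3⟩ := h
  have hm : ∀ d, d ∈ v.map f ↔ f d ∈ v := fun d => by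
    simp only [List.mem_map]
    exact ⟨by rintro ⟨a, ha, rfl⟩; rwa [hf], fun h => ⟨_, h, hf d⟩⟩
  simp only [List.mem_append] at h2 h3
  refine ⟨?_, fun d => ?_, fun d hd => ?_⟩
  · simp only [List.nodup_append, List.mem_append] at h1 ⊢
    refine ⟨⟨h1.1.1, h1.1.2.1.map hfi, ?_⟩, h1.2.1, ?_⟩
    · rintro a ha b hb rfl
      exact h3 a (.inl (.inl ha)) (.inl (.inr ((hm a).1 hb)))
    · rintro a (ha | ha) b hb rfl
      · exact h1.2.2 a (.inl ha) a hb rfl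
      · exact h3 a (.inr hb) (.inl (.inr ((hm a).1 ha)))
  · simp only [List.mem_append, hm, hf]
    have := h2 d
    tauto
  · simp only [List.mem_append, hm, hf] at hd ⊢
    have a := h3 d
    have b := h3 (f d)
    simp only [hf] at b
    have c : d ∈ v → d ∉ u ∧ d ∉ w := fun hv => by
      simp only [List.nodup_append, List.mem_append] at h1
      exact ⟨fun hu => h1.1.2.2 d hu d hv rfl, fun hw => h1.2.2 d (.inr hv) d hw rfl⟩
    have c' : f d ∈ v → f d ∉ u ∧ f d ∉ w := fun hv => by
      simp only [List.nodup_append, List.mem_append] at h1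
      exact ⟨fun hu => h1.1.2.2 _ hu _ hv rfl, fun hw => h1.2.2 _ (.inr hv) _ hw rfl⟩
    tauto

theorem IsTrace.perm {D D' : List (List (MedialDart X))} (h : IsTrace f σ D) (hD : D.Perm D') :
    IsTrace f σ D' :=
  ⟨fun w hw => h.closed w (hD.mem_iff.2 hw), h.half.perm hD.flatten⟩

theorem IsTrace.rotate {u v : List (MedialDart X)} {D : List (List (MedialDart X))}
    (h : IsTrace f σ ((u ++ v) :: D)) : IsTrace f σ ((v ++ u) :: D) := by
  refine ⟨?_, h.half.perm ?_⟩
  · have := h.closed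
    simp only [List.mem_cons, forall_eq_or_imp] at this ⊢
    exact ⟨this.1.rotate, this.2⟩
  · simp only [List.flatten_cons]
    exact List.perm_append_comm.append_right _

/-- The mate of an outgoing dart is the arriving half of the preceding medial edge, whose other half
was chosen. -/
theorem IsTrace.mate_not_mem {D : List (List (MedialDart X))}
    (h : IsTrace f σ D) {d : MedialDart X} (hd : d ∈ D.flatten) : mate σ d ∉ D.flatten := by
  obtain ⟨w, hw, hdw⟩ := List.mem_flatten.1 hd
  obtain ⟨a, ha, rfl⟩ := (h.closed w hw).exists_pred hdw
  rw [mate_mate]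
  exact h.half.not_mem a (List.mem_flatten.2 ⟨w, hw, ha⟩)

theorem IsTrace.mem_or_mate_mem {D : List (List (MedialDart X))} (hf : ∀ d, f (f d) = d)
    (h : IsTrace f σ D) (d : MedialDart X) : d ∈ D.flatten ∨ mate σ d ∈ D.flatten := by
  refine (h.half.mem_or d).imp_right fun hd => ?_
  obtain ⟨w, hw, hdw⟩ := List.mem_flatten.1 hd
  have := (h.closed w hw).succ_mem hdw
  rw [hf] at this
  exact List.mem_flatten.2 ⟨w, hw, this⟩

/-- Two strands `p :: u` and `q :: v` of the curves of a state between visits of the vertex `x`. -/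
structure IsStrandPair (f : MedialDart X → MedialDart X) (σ : X → Option Bool) (x : X)
    (p : MedialDart X) (u : List (MedialDart X)) (y q : MedialDart X) (v : List (MedialDart X))
    (z : MedialDart X) (D : List (List (MedialDart X))) : Prop where
  left : IsWalk f σ p u y
  right : IsWalk f σ q v z
  closed : ∀ w ∈ D, IsClosedWalk f σ w
  half : IsHalf f (p :: u ++ q :: v ++ D.flatten)
  hp : p.1.1 = x
  hq : q.1.1 = x
  ne_left : ∀ b ∈ u, b.1.1 ≠ x
  ne_right : ∀ b ∈ v, b.1.1 ≠ x
  ne_rest : ∀ b ∈ D.flatten, b.1.1 ≠ x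

namespace IsStrandPair

variable {x : X} {p y q z : MedialDart X} {u v : List (MedialDart X)}
  {D : List (List (MedialDart X))}

/-- The strands only start and end at `x`, so the matching there may be changed freely. -/
theorem congr (h : IsStrandPair f σ x p u y q v z D) (hσ : ∀ e ≠ x, σ e = σ' e) :
    IsStrandPair f σ' x p u y q v z D where
  left := h.left.congr fun b hb => hσ _ (h.ne_left b hb)
  right := h.right.congr fun b hb => hσ _ (h.ne_right b hb)
  closed := fun w hw => (h.closed w hw).congr fun b hb =>
    hσ _ (h.ne_rest b (List.mem_flatten.2 ⟨w, hw, hb⟩))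
  half := h.half
  hp := h.hp
  hq := h.hq
  ne_left := h.ne_left
  ne_right := h.ne_right
  ne_rest := h.ne_rest

theorem isTrace_split (h : IsStrandPair f σ x p u y q v z D)
    (hp : p = mate σ y) (hq : q = mate σ z) : IsTrace f σ ((p :: u) :: (q :: v) :: D) := by
  refine ⟨?_, ?_⟩
  · simp only [List.mem_cons, forall_eq_or_imp]
    exact ⟨⟨y, h.left, hp⟩, ⟨z, h.right, hq⟩, h.closed⟩
  · simpa using h.half

theorem isTrace_join (h : IsStrandPair f σ x p u y q v z D)
    (hq : q = mate σ y) (hp : p = mate σ z) : IsTrace f σ ((p :: u ++ q :: v) :: D) := by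
  refine ⟨?_, ?_⟩
  · simp only [List.mem_cons, forall_eq_or_imp]
    exact ⟨⟨z, isWalk_append.2 ⟨y, h.left, hq, h.right⟩, hp⟩, h.closed⟩
  · simpa using h.half

theorem isTrace_join_reverse (hf : ∀ d, f (f d) = d) (h : IsStrandPair f σ x p u y q v z D)
    (hz : z = mate σ y) (hp : p = mate σ q) :
    IsTrace f σ ((p :: u ++ z :: (v.map (mate σ)).reverse) :: D) := by
  refine ⟨?_, ?_⟩
  · simp only [List.mem_cons, forall_eq_or_imp]
    exact ⟨⟨q, isWalk_append.2 ⟨y, h.left, hz, h.right.reverse hf⟩, hp⟩, h.closed⟩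
  · refine (h.half.flip_part hf).perm ?_
    rw [List.flatten_cons]
    exact (h.right.reverse_perm.symm.append_left _).append_right _

end IsStrandPair

end States

/-! ### Crossing signs and the two visits of a medial vertex -/

section Signs

variable {X : Type*}

/-- The sign `1` or `-1` of an end of an edge. -/
def endSign (s : Bool) : ℤ := if s then 1 else -1

theorem endSign_not (s : Bool) : endSign (!s) = -endSign s := by cases s <;> rfl

open Classical in
/-- The sign of the crossing of two visits at a vertex, given by their outgoing darts: it is `1` if
the first visit crosses the second one from right to left, `-1` if it does so from left to right,
and `0` if the darts do not belong to two visits that cross each other. -/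
noncomputable def crossSign (σ : X → Option Bool) (a b : MedialDart X) : ℤ :=
  -- Opposite darts share the last bit, so this bit names the strand through the crossing, while the
  -- end bit gives its direction.
  if a.1.1 = b.1.1 ∧ σ a.1.1 = none then
    endSign a.1.2 * endSign b.1.2 * (b.2.toInt - a.2.toInt)
  else 0

variable {σ σ' : X → Option Bool}

theorem crossSign_comm (σ : X → Option Bool) (a b : MedialDart X) :
    crossSign σ b a = -crossSign σ a b := by
  unfold crossSign
  by_cases h : a.1.1 = b.1.1
  · by_cases h' : σ a.1.1 = none
    · have h'' : σ b.1.1 = none := h ▸ h'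
      rw [if_pos (And.intro h.symm h''), if_pos (And.intro h h')]; ring
    · have h'' : σ b.1.1 ≠ none := h ▸ h'
      simp [h', h'']
  · simp [h, Ne.symm h]

theorem crossSign_congr {a b : MedialDart X} (h : σ a.1.1 = none ↔ σ' a.1.1 = none) :
    crossSign σ a b = crossSign σ' a b := by
  by_cases h1 : a.1.1 = b.1.1 ∧ σ a.1.1 = none
  · rw [crossSign, crossSign, if_pos h1, if_pos (And.intro h1.1 (h.1 h1.2))]
  · rw [crossSign, crossSign, if_neg h1, if_neg fun h2 => h1 ⟨h2.1, h.2 h2.2⟩]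

theorem crossSign_of_ne_none {a : MedialDart X} (h : σ a.1.1 ≠ none) (b : MedialDart X) :
    crossSign σ a b = 0 := by
  simp [crossSign, h]

theorem crossSign_of_vertex_ne {a b : MedialDart X} (h : a.1.1 ≠ b.1.1) :
    crossSign σ a b = 0 := by
  simp [crossSign, h]

theorem crossSign_self (a : MedialDart X) : crossSign σ a a = 0 := by
  simp [crossSign]

/-- Every crossing of `σ'` is a crossing of `σ`, where the mate is the opposite dart; reversing a
strand reverses the sign. -/
theorem crossSign_mate (h : ∀ e, σ' e = none → σ e = none) (a b : MedialDart X) :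
    crossSign σ' (mate σ a) b = -crossSign σ' a b := by
  by_cases h1 : a.1.1 = b.1.1 ∧ σ' a.1.1 = none
  · rw [crossSign, crossSign, if_pos h1, if_pos (by rwa [mate_fst_fst]), mate, h _ h1.2]
    simp only [mateOf, endSign_not]
    ring
  · rw [crossSign, crossSign, if_neg h1, if_neg (by rwa [mate_fst_fst]), neg_zero]

theorem crossSign_ne_zero {a b : MedialDart X} (h : crossSign σ a b ≠ 0) :
    a.1.1 = b.1.1 ∧ σ a.1.1 = none ∧ a.2 ≠ b.2 := by
  unfold crossSign at h
  split_ifs at h with h1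
  · exact ⟨h1.1, h1.2, fun h2 => h (by simp [h2])⟩
  · exact absurd rfl h

theorem crossSign_sq {a b : MedialDart X} (h : a.1.1 = b.1.1) (hσ : σ a.1.1 = none)
    (hab : a.2 ≠ b.2) : crossSign σ a b ^ 2 = 1 := by
  rcases a with ⟨⟨e, s⟩, t⟩
  rcases b with ⟨⟨e', s'⟩, t'⟩
  rw [crossSign, if_pos ⟨h, hσ⟩]
  cases s <;> cases s' <;> cases t <;> cases t' <;> simp_all [endSign]

theorem cross_cons_left {α : Type*} (E : α → α → ℤ) (a : α) (u v : List α) :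
    cross E (a :: u) v = sum1 (E a) v + cross E u v := rfl

theorem cross_cons_right {α : Type*} (E : α → α → ℤ) (a : α) (u v : List α) :
    cross E u (a :: v) = sum1 (fun b => E b a) u + cross E u v := by
  unfold cross
  simp only [sum1, sum1_add]

/-- The property of a surface that any two different curves of a state have algebraic intersection
number zero. -/
def Unlinked (f : MedialDart X → MedialDart X) : Prop :=
  ∀ (σ : X → Option Bool) (U V : List (MedialDart X)) (D : List (List (MedialDart X))),
    IsTrace f σ (U :: V :: D) → cross (crossSign σ) U V = 0

variable {f : MedialDart X → MedialDart X} {D : List (List (MedialDart X))}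
  {p q : MedialDart X} {u v : List (MedialDart X)}

/-- Different darts at a crossing with equal last bit are opposite, hence mates, and cannot both be
outgoing. -/
theorem IsTrace.snd_ne_of_crossing (h : IsTrace f σ D) {a b : MedialDart X}
    (ha : a ∈ D.flatten) (hb : b ∈ D.flatten) (hab : a.1.1 = b.1.1) (hσ : σ a.1.1 = none)
    (hne : a ≠ b) : a.2 ≠ b.2 := by
  intro h2
  refine h.mate_not_mem ha ?_
  convert hb
  rcases a with ⟨⟨e, s⟩, t⟩
  rcases b with ⟨⟨e', s'⟩, t'⟩
  simp only at hab h2 hσ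
  subst hab h2
  have : s ≠ s' := fun h => hne (by rw [h])
  simp [mate, mateOf, hσ]
  cases s <;> cases s' <;> simp_all

/-- A vertex is visited at most twice: two outgoing darts and their mates exhaust its four darts,
and mates are not outgoing. -/
theorem IsTrace.eq_or_eq (h : IsTrace f σ D) {a b c : MedialDart X}
    (ha : a ∈ D.flatten) (hb : b ∈ D.flatten) (hc : c ∈ D.flatten) (hab : a.1.1 = b.1.1)
    (hac : c.1.1 = a.1.1) (hne : b ≠ a) : c = a ∨ c = b := by
  have hb' : b ≠ mateOf (σ a.1.1) a := fun hh => h.mate_not_mem ha (by rw [mate, ← hh]; exact hb)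
  rcases eq_or_eq_of_two_matched_pairs (σ a.1.1) hab hac hne hb' with h1 | h1 | h1 | h1
  · exact .inl h1
  · exact absurd hc (by rw [h1]; exact h.mate_not_mem ha)
  · exact .inr h1
  · exact absurd hc (by rw [h1, hab]; exact h.mate_not_mem hb)

/-- The visits `p` and `q` are the only ones at their vertex, so the rest of the curve consists of
two strands that avoid it. -/
theorem IsTrace.exists_strandPair_of_join (h : IsTrace f σ ((p :: u ++ q :: v) :: D))
    (hx : p.1.1 = q.1.1) :
    ∃ y z, IsStrandPair f σ p.1.1 p u y q v z D ∧ q = mate σ y ∧ p = mate σ z := by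
  obtain ⟨z, h1, hz⟩ := h.closed _ (.head _)
  obtain ⟨y, h2, hy, h3⟩ := isWalk_append.1 h1
  have hn := h.half.nodup
  have hqp : q ≠ p := by simp at hn; grind
  have key : ∀ b, b ∈ u ∨ b ∈ v ∨ b ∈ D.flatten → b.1.1 ≠ p.1.1 := fun b hb hbx => by
    have hb' : b ∈ ((p :: u ++ q :: v) :: D).flatten := by
      simp only [List.flatten_cons, List.mem_append, List.mem_cons]; tauto
    rcases h.eq_or_eq (a := p) (b := q) (by simp) (by simp) hb' hx hbx hqp with rfl | rfl
    all_goals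
      simp only [List.flatten_cons, List.nodup_append, List.nodup_cons, List.mem_append,
        List.cons_append, List.mem_cons] at hn
      grind
  exact ⟨y, z, ⟨h2, h3, fun w hw => h.closed w (.tail _ hw), by simpa using h.half, rfl, hx.symm,
    fun b hb => key b (.inl hb), fun b hb => key b (.inr (.inl hb)),
    fun b hb => key b (.inr (.inr hb))⟩, hy, hz⟩

theorem IsTrace.exists_strandPair_of_split (h : IsTrace f σ ((p :: u) :: (q :: v) :: D))
    (hx : p.1.1 = q.1.1) :
    ∃ y z, IsStrandPair f σ p.1.1 p u y q v z D ∧ p = mate σ y ∧ q = mate σ z := by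
  obtain ⟨y, h2, hy⟩ := h.closed _ (.head _)
  obtain ⟨z, h3, hz⟩ := h.closed _ (.tail _ (.head _))
  have hn := h.half.nodup
  have hqp : q ≠ p := by simp at hn; grind
  have key : ∀ b, b ∈ u ∨ b ∈ v ∨ b ∈ D.flatten → b.1.1 ≠ p.1.1 := fun b hb hbx => by
    have hb' : b ∈ ((p :: u) :: (q :: v) :: D).flatten := by
      simp only [List.flatten_cons, List.mem_append, List.mem_cons]; tauto
    rcases h.eq_or_eq (a := p) (b := q) (by simp) (by simp) hb' hx hbx hqp with rfl | rfl
    all_goals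
      simp only [List.flatten_cons, List.nodup_append, List.nodup_cons, List.mem_append,
        List.cons_append, List.mem_cons] at hn
      grind
  exact ⟨y, z, ⟨h2, h3, fun w hw => h.closed w (.tail _ (.tail _ hw)), by simpa using h.half, rfl,
    hx.symm, fun b hb => key b (.inl hb), fun b hb => key b (.inr (.inl hb)),
    fun b hb => key b (.inr (.inr hb))⟩, hy, hz⟩

open Classical in
theorem update_trace_eq (σ : X → Option Bool) (x : X) (τ : Option Bool) :
    ∀ e ≠ x, σ e = Function.update σ x τ e := fun e he => by simp [he]

open Classical in
theorem mate_update (σ : X → Option Bool) {d : MedialDart X} {x : X} (hd : d.1.1 = x)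
    (τ : Option Bool) : mate (Function.update σ x τ) d = mateOf τ d := by
  simp [mate, hd]

open Classical in
theorem IsStrandPair.map_mate {x : X} {y z : MedialDart X} (h : IsStrandPair f σ x p u y q v z D)
    (τ : Option Bool) : v.map (mate (Function.update σ x τ)) = v.map (mate σ) :=
  List.map_congr_left fun b hb => mate_congr (update_trace_eq σ x τ _ (h.ne_right b hb)).symm

open Classical in
/-- The two other ways to connect the strands at a vertex that is visited twice by one curve. -/
theorem IsTrace.exists_of_join (hf : ∀ d, f (f d) = d)
    (h : IsTrace f σ ((p :: u ++ q :: v) :: D)) (hx : p.1.1 = q.1.1) :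
    ∃ z τ τ', τ ≠ σ p.1.1 ∧ τ' ≠ σ p.1.1 ∧ τ ≠ τ' ∧ z.1.1 = p.1.1 ∧
      IsTrace f (Function.update σ p.1.1 τ) ((p :: u) :: (q :: v) :: D) ∧
      IsTrace f (Function.update σ p.1.1 τ')
        ((p :: u ++ z :: (v.map (mate σ)).reverse) :: D) := by
  obtain ⟨y, z, hs, hy, hz⟩ := h.exists_strandPair_of_join hx
  have hn := h.half.nodup
  have hqp : q ≠ p := by simp at hn; grind
  -- `τ'` matches the two outgoing darts and hence reverses one strand. The remaining `τ` respects
  -- both directions and closes each strand up.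
  obtain ⟨τ', hτ'⟩ := exists_mateOf_eq hx hqp
  have hne : σ p.1.1 ≠ τ' := fun hh =>
    h.mate_not_mem (d := p) (by simp) (by rw [mate, hh, ← hτ']; simp)
  obtain ⟨τ, h1, h2, h3⟩ := exists_third_mateOf (X := X) hne
  have hyq : y = mate σ q := by rw [hy, mate_mate]
  have hzp : z = mate σ p := by rw [hz, mate_mate]
  have hyx : y.1.1 = p.1.1 := by rw [hyq, mate_fst_fst, hx]
  have hzx : z.1.1 = p.1.1 := by rw [hzp, mate_fst_fst]
  refine ⟨z, τ, τ', h1, hne.symm, h2, hzx, ?_, ?_⟩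
  · refine (hs.congr (update_trace_eq σ _ τ)).isTrace_split ?_ ?_
    · rw [mate_update σ hyx, hyq, mate, ← hx, hτ', mateOf_comm (σ p.1.1), (h3 _).2, mateOf_mateOf]
    · rw [mate_update σ hzx, hzp, mate, (h3 _).1, hτ']
  · have := (hs.congr (update_trace_eq σ _ τ')).isTrace_join_reverse hf ?_ ?_
    · rwa [hs.map_mate] at this
    · rw [mate_update σ hyx, hyq, mate, ← hx, hτ', mateOf_comm τ', mateOf_mateOf, hzp, mate]
    · rw [mate_update σ hx.symm, hτ', mateOf_mateOf]

open Classical in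
/-- The two other ways to connect the strands at a vertex that is visited by two curves. -/
theorem IsTrace.exists_of_split (hf : ∀ d, f (f d) = d)
    (h : IsTrace f σ ((p :: u) :: (q :: v) :: D)) (hx : p.1.1 = q.1.1) :
    ∃ z τ τ', τ ≠ σ p.1.1 ∧ τ' ≠ σ p.1.1 ∧ τ ≠ τ' ∧ z.1.1 = p.1.1 ∧
      IsTrace f (Function.update σ p.1.1 τ) ((p :: u ++ q :: v) :: D) ∧
      IsTrace f (Function.update σ p.1.1 τ')
        ((p :: u ++ z :: (v.map (mate σ)).reverse) :: D) := by
  obtain ⟨y, z, hs, hy, hz⟩ := h.exists_strandPair_of_split hx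
  have hn := h.half.nodup
  have hqp : q ≠ p := by simp at hn; grind
  obtain ⟨τ', hτ'⟩ := exists_mateOf_eq hx hqp
  have hne : σ p.1.1 ≠ τ' := fun hh =>
    h.mate_not_mem (d := p) (by simp) (by rw [mate, hh, ← hτ']; simp)
  obtain ⟨τ, h1, h2, h3⟩ := exists_third_mateOf (X := X) hne
  have hyp : y = mate σ p := by rw [hy, mate_mate]
  have hzq : z = mate σ q := by rw [hz, mate_mate]
  have hyx : y.1.1 = p.1.1 := by rw [hyp, mate_fst_fst]
  have hzx : z.1.1 = p.1.1 := by rw [hzq, mate_fst_fst, hx]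
  refine ⟨z, τ, τ', h1, hne.symm, h2, hzx, ?_, ?_⟩
  · refine (hs.congr (update_trace_eq σ _ τ)).isTrace_join ?_ ?_
    · rw [mate_update σ hyx, hyp, mate, (h3 _).1, hτ']
    · rw [mate_update σ hzx, hzq, mate, ← hx, hτ', mateOf_comm (σ p.1.1), (h3 _).2, mateOf_mateOf]
  · have := (hs.congr (update_trace_eq σ _ τ')).isTrace_join_reverse hf ?_ ?_
    · rwa [hs.map_mate] at this
    · rw [mate_update σ hyx, hyp, hzq, mate, mate, ← hx, hτ', mateOf_comm]
    · rw [mate_update σ hx.symm, hτ', mateOf_mateOf]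

open Classical in
/-- At a crossing that a curve has with itself, the two parts of the curve are unlinked. -/
theorem IsTrace.cross_eq_zero_of_join (hf : ∀ d, f (f d) = d) (hU : Unlinked f)
    (h : IsTrace f σ ((p :: u ++ q :: v) :: D)) (hpq : crossSign σ p q ≠ 0) :
    cross (crossSign σ) u v = 0 := by
  obtain ⟨hx, hσ, -⟩ := crossSign_ne_zero hpq
  obtain ⟨y, z', hs, -⟩ := h.exists_strandPair_of_join hx
  -- Smoothing in the direction of the curve makes its two parts different closed curves, and `p`
  -- and `q` then cross nothing.
  obtain ⟨z, τ, τ', h1, -, -, -, h2, -⟩ := h.exists_of_join hf hx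
  have h3 := hU _ _ _ _ h2
  have hp0 : ∀ b, crossSign (Function.update σ p.1.1 τ) p b = 0 :=
    crossSign_of_ne_none (by simpa [hσ] using h1)
  have hq0 : ∀ b, crossSign (Function.update σ p.1.1 τ) b q = 0 := fun b => by
    rw [crossSign_comm, crossSign_of_ne_none (by rw [← hx]; simpa [hσ] using h1), neg_zero]
  rw [cross_cons_left, cross_cons_right, sum1_congr fun b _ => hp0 b,
    sum1_congr fun b _ => hq0 b, sum1_zero, sum1_zero, zero_add, zero_add] at h3
  rw [← h3]
  exact cross_congr fun a ha b _ => crossSign_congr (by rw [update_trace_eq σ _ τ _ (hs.ne_left a ha)])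

/-- The weight of a curve does not depend on its basepoint: each visit passed by the basepoint
either crosses nothing on the curve or splits it into unlinked parts. -/
theorem IsTrace.weight_rotate (hf : ∀ d, f (f d) = d) (hU : Unlinked f)
    (h : IsTrace f σ ((u ++ v) :: D)) :
    weight (crossSign σ) (v ++ u) = weight (crossSign σ) (u ++ v) := by
  induction u generalizing v with
  | nil => simp
  | cons a u ih =>
    have h1 : IsTrace f σ ((u ++ (v ++ [a])) :: D) := by
      have := IsTrace.rotate (u := [a]) (v := u ++ v) (by simpa using h)
      simpa using this
    rw [show v ++ a :: u = (v ++ [a]) ++ u by simp, ih h1, ← List.append_assoc,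
      weight_rotate_one (crossSign_comm σ), List.cons_append]
    intro w₁ k w₂ hw hk
    refine IsTrace.cross_eq_zero_of_join hf hU (p := a) (q := k) (D := D) ?_ hk
    rw [List.cons_append, ← hw]
    exact h

end Signs

/-! ### The three-term relation at a crossing -/

section StateSum

variable {X : Type*} {f : MedialDart X → MedialDart X} {σ σ₀ : X → Option Bool}
  {D : List (List (MedialDart X))} {p q : MedialDart X} {u v : List (MedialDart X)}

open Classical in
/-- The linking of the loops of one strand with another strand does not contribute. -/
theorem IsTrace.sum3_between (hf : ∀ d, f (f d) = d) (hU : Unlinked f)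
    (h : IsTrace f σ ((p :: u) :: (q :: v) :: D)) (hpq : p.1.1 = q.1.1)
    (hσ : ∀ e ≠ p.1.1, σ e = σ₀ e) :
    sum3 (fun i j k => crossSign σ₀ i k * sum1 (crossSign σ₀ j) v) u = 0 := by
  obtain ⟨y, z, hs, -⟩ := h.exists_strandPair_of_split hpq
  refine sum3_eq_zero_of_between u fun w₁ i w₂ k w₃ hu hik => ?_
  obtain ⟨hx, hi0, hik2⟩ := crossSign_ne_zero hik
  have hip : i.1.1 ≠ p.1.1 := hs.ne_left i (by simp [hu])
  have hσi : σ i.1.1 = none := by rw [hσ _ hip, hi0]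
  have hki : k ≠ i := fun hh => hik2 (by rw [hh])
  have h1 : IsTrace f σ ((i :: w₂ ++ k :: (w₃ ++ p :: w₁)) :: (q :: v) :: D) := by
    have := IsTrace.rotate (u := p :: w₁) (v := i :: w₂ ++ k :: w₃) (f := f) (σ := σ)
      (D := (q :: v) :: D) (by simpa [hu] using h)
    simpa using this
  obtain ⟨y', z', hs', -⟩ := h1.exists_strandPair_of_join hx
  -- Smoothing the self-crossing of `i` and `k` splits off the loop `i :: w₂`, which is then
  -- unlinked with `q :: v`.
  obtain ⟨_, τ, _, hτ, -, -, -, h2, -⟩ := h1.exists_of_join hf hx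
  have h3 := hU _ _ _ _ (h2.perm (((List.Perm.swap _ _ _)).cons _))
  have hp0 : ∀ b, crossSign (Function.update σ i.1.1 τ) i b = 0 :=
    crossSign_of_ne_none (by simpa [hσi] using hτ)
  have hw : ∀ a ∈ w₂, a.1.1 ≠ p.1.1 := fun a ha => hs.ne_left a (by simp [hu, ha])
  rw [cross_cons_left, cross_cons_right, sum1_congr fun b _ => hp0 b, sum1_zero,
    sum1_congr fun a ha => crossSign_of_vertex_ne fun hh => hw a ha (hh.trans hpq.symm),
    sum1_zero, zero_add, zero_add] at h3
  change cross _ w₂ v = 0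
  rw [← h3]
  exact cross_congr fun a ha b _ => crossSign_congr (by
    rw [← update_trace_eq σ _ τ _ (hs'.ne_left a ha), hσ _ (hw a ha)])

/-- A vertex that a curve visits only once does not contribute to the weight of the curve. -/
theorem weight_of_single_visit {x : X} (hp : p.1.1 = x) (hσ : ∀ e ≠ x, σ e = σ₀ e)
    (h0 : σ₀ x ≠ none) (hu : ∀ b ∈ u, b.1.1 ≠ x) :
    weight (crossSign σ) (p :: u) = weight (crossSign σ₀) u := by
  rw [weight_congr (E' := crossSign σ₀), ← List.nil_append (p :: u),
    weight_insert_null (crossSign_comm _) (crossSign_of_ne_none (by rwa [hp])), List.nil_append]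
  have hmem : ∀ a ∈ p :: u, a.1.1 = x → a = p := fun a ha hax => by
    rcases List.mem_cons.1 ha with h | h
    · exact h
    · exact absurd hax (hu a h)
  intro a ha b hb
  by_cases hap : a.1.1 = x
  · by_cases hbp : b.1.1 = x
    · rw [hmem a ha hap, hmem b hb hbp, crossSign_self, crossSign_self]
    · rw [crossSign_of_vertex_ne (by rw [hap]; exact Ne.symm hbp),
        crossSign_of_vertex_ne (by rw [hap]; exact Ne.symm hbp)]
  · exact crossSign_congr (by rw [hσ _ hap])

/-- The total weight of the curves of a state. -/
noncomputable def totalWeight (σ : X → Option Bool) (D : List (List (MedialDart X))) : ℤ :=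
  (D.map (weight (crossSign σ))).sum

theorem totalWeight_cons (w : List (MedialDart X)) :
    totalWeight σ (w :: D) = weight (crossSign σ) w + totalWeight σ D := by
  simp [totalWeight]

theorem totalWeight_perm {D' : List (List (MedialDart X))} (h : D.Perm D') :
    totalWeight σ D = totalWeight σ D' := (h.map _).sum_eq

theorem totalWeight_congr (h : ∀ b ∈ D.flatten, σ b.1.1 = none ↔ σ₀ b.1.1 = none) :
    totalWeight σ D = totalWeight σ₀ D := by
  unfold totalWeight
  congr 1
  refine List.map_congr_left fun w hw => weight_congr fun a ha b _ => crossSign_congr ?_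
  exact h a (List.mem_flatten.2 ⟨w, hw, ha⟩)

/-- The two ways to join a pair of strands, with the weights measured away from their ends. -/
theorem IsTrace.weight_join_add_weight_join_reverse (hf : ∀ d, f (f d) = d) (hU : Unlinked f)
    (h : IsTrace f σ ((p :: u) :: (q :: v) :: D)) (hpq : p.1.1 = q.1.1)
    {ν : MedialDart X → MedialDart X}
    (hν : ∀ a b, crossSign σ₀ (ν a) b = -crossSign σ₀ a b)
    (hσ : ∀ e ≠ p.1.1, σ e = σ₀ e) :
    weight (crossSign σ₀) (u ++ v) + weight (crossSign σ₀) (u ++ (v.map ν).reverse) =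
      2 * (weight (crossSign σ₀) u + weight (crossSign σ₀) v) +
        2 * cross (crossSign σ₀) u v ^ 2 := by
  obtain ⟨y, z, hs, -⟩ := h.exists_strandPair_of_split hpq
  have hn : (p :: u ++ q :: v ++ D.flatten).Nodup := hs.half.nodup
  have hmu : ∀ a ∈ u, a ∈ ((p :: u) :: (q :: v) :: D).flatten := fun a ha => by simp [ha]
  have hmv : ∀ a ∈ v, a ∈ ((p :: u) :: (q :: v) :: D).flatten := fun a ha => by simp [ha]
  -- Three visits that pairwise cross at one vertex would need three different last bits.
  have key : ∀ a b c, a ∈ ((p :: u) :: (q :: v) :: D).flatten →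
      b ∈ ((p :: u) :: (q :: v) :: D).flatten → a ≠ b → a.1.1 ≠ p.1.1 →
      crossSign σ₀ a c * crossSign σ₀ b c = 0 := by
    intro a b c ha hb hab hap
    by_contra hh
    obtain ⟨h1, h2, h3⟩ := crossSign_ne_zero (left_ne_zero_of_mul hh)
    obtain ⟨h4, h5, h6⟩ := crossSign_ne_zero (right_ne_zero_of_mul hh)
    refine h.snd_ne_of_crossing ha hb (h1.trans h4.symm) (by rw [hσ _ hap, h2]) hab ?_
    cases h7 : a.2 <;> cases h8 : b.2 <;> cases h9 : c.2 <;> simp_all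
  have hnu : u.Nodup := by simp at hn; grind
  have hnv : v.Nodup := by simp at hn; grind
  refine weight_append_add_weight_append_reverse (crossSign_comm σ₀) hν u v ?_ ?_
    (h.sum3_between hf hU hpq hσ) ?_
  · exact List.Pairwise.imp_of_mem (fun ha hb hab c _ =>
      key _ _ c (hmu _ ha) (hmu _ hb) hab (hs.ne_left _ ha)) hnu
  · refine List.Pairwise.imp_of_mem (fun ha hb hab c _ => ?_) hnv
    rw [crossSign_comm _ _ c, crossSign_comm _ _ c, neg_mul_neg]
    exact key _ _ c (hmv _ ha) (hmv _ hb) hab (hs.ne_right _ ha)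
  · exact (h.perm (.swap _ _ _)).sum3_between hf hU hpq.symm (by rwa [← hpq])

/-- Every trace can be rearranged so that it shows two strands between the visits of a vertex. -/
theorem IsTrace.exists_strands (hf : ∀ d, f (f d) = d) (hU : Unlinked f) (h : IsTrace f σ D)
    (x : X) : ∃ p u q v D', p.1.1 = x ∧ q.1.1 = x ∧
      ((IsTrace f σ ((p :: u) :: (q :: v) :: D') ∧ D.length = D'.length + 2 ∧
          totalWeight σ D = totalWeight σ ((p :: u) :: (q :: v) :: D')) ∨
        (IsTrace f σ ((p :: u ++ q :: v) :: D') ∧ D.length = D'.length + 1 ∧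
          totalWeight σ D = totalWeight σ ((p :: u ++ q :: v) :: D'))) := by
  -- Any outgoing dart can be made the start of the first curve without changing the total weight.
  have pull : ∀ d : MedialDart X, ∀ D, IsTrace f σ D → d ∈ D.flatten →
      ∃ w D', IsTrace f σ ((d :: w) :: D') ∧ D.length = D'.length + 1 ∧
        totalWeight σ D = totalWeight σ ((d :: w) :: D') ∧
        (∀ b ∈ D.flatten, b ≠ d → b ∈ w ∨ b ∈ D'.flatten) := by
    intro d D h hd
    obtain ⟨w, hw, hdw⟩ := List.mem_flatten.1 hd
    obtain ⟨D', hD'⟩ : ∃ D', D.Perm (w :: D') := by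
      obtain ⟨s, t, rfl⟩ := List.append_of_mem hw
      exact ⟨s ++ t, List.perm_middle⟩
    obtain ⟨s, t, rfl⟩ := List.append_of_mem hdw
    have h1 := h.perm hD'
    refine ⟨t ++ s, D', h1.rotate, by simpa using hD'.length_eq, ?_, fun b hb hbd => ?_⟩
    · rw [totalWeight_perm hD', totalWeight_cons, totalWeight_cons, ← h1.weight_rotate hf hU]
      rfl
    · have := hD'.flatten.mem_iff.1 hb
      simp only [List.flatten_cons, List.mem_append, List.mem_cons] at this ⊢
      tauto
  obtain ⟨p, hp, hpx⟩ : ∃ p ∈ D.flatten, p.1.1 = x := by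
    rcases h.mem_or_mate_mem hf ((x, true), true) with h1 | h1
    · exact ⟨_, h1, rfl⟩
    · exact ⟨_, h1, by simp⟩
  obtain ⟨q, hq, hqx, hqp⟩ : ∃ q ∈ D.flatten, q.1.1 = x ∧ q ≠ p := by
    -- A matching other than that of the state leads from `p` to the other strand at `x`; one of the
    -- two darts of that strand is outgoing.
    obtain ⟨τ, hτ⟩ := exists_ne (σ x)
    rcases h.mem_or_mate_mem hf (mateOf τ p) with h1 | h1
    · exact ⟨_, h1, by simp [hpx], mateOf_ne _ _⟩
    · refine ⟨_, h1, by simp [hpx], fun hh => ?_⟩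
      have h2 : mateOf τ p = mateOf (σ x) p := by
        rw [← mate_mate σ (mateOf τ p), hh, mate, hpx]
      exact hτ (mateOf_left_injective p h2)
  obtain ⟨w, D₁, h1, h2, h3, h4⟩ := pull p D h hp
  rcases h4 q hq hqp with hqw | hqD
  · obtain ⟨u, v, rfl⟩ := List.append_of_mem hqw
    exact ⟨p, u, q, v, D₁, hpx, hqx, .inr ⟨h1, h2, h3⟩⟩
  · obtain ⟨w', hw', hqw'⟩ := List.mem_flatten.1 hqD
    obtain ⟨D₂, hD₂⟩ : ∃ D₂, D₁.Perm (w' :: D₂) := by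
      obtain ⟨s, t, rfl⟩ := List.append_of_mem hw'
      exact ⟨s ++ t, List.perm_middle⟩
    obtain ⟨s, t, rfl⟩ := List.append_of_mem hqw'
    have hperm : ((p :: w) :: D₁).Perm ((s ++ q :: t) :: (p :: w) :: D₂) :=
      (hD₂.cons _).trans (.swap _ _ _)
    have h5 := h1.perm hperm
    refine ⟨p, w, q, t ++ s, D₂, hpx, hqx, .inl ⟨h5.rotate.perm (.swap _ _ _), ?_, ?_⟩⟩
    · have := hD₂.length_eq
      simp only [List.length_cons] at this
      omega
    · rw [h3, totalWeight_perm hperm]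
      simp only [totalWeight_cons]
      rw [← h5.weight_rotate hf hU, List.cons_append]
      ring

/-- The value `(-2) ^ c * (2 * c + n + 3 * weight)` of the `c` curves of a state, where `n` stands
for the number of crossings. -/
noncomputable def potential (σ : X → Option Bool) (D : List (List (MedialDart X))) (n : ℤ) : ℤ :=
  (-2) ^ D.length * (2 * D.length + n + 3 * totalWeight σ D)

open Classical in
theorem crossSign_update {x : X} {τ τ' : Option Bool} (h : τ ≠ none) (h' : τ' ≠ none) :
    crossSign (Function.update σ x τ) = crossSign (Function.update σ x τ') := by
  funext a b
  refine crossSign_congr ?_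
  by_cases hx : a.1.1 = x
  · simp [hx, h, h']
  · simp [hx]

open Classical in
/-- Resolving a crossing in both ways. -/
theorem IsTrace.exists_smoothings (hf : ∀ d, f (f d) = d) (hU : Unlinked f) (h : IsTrace f σ D)
    {x : X} (hx : σ x = none) :
    ∃ (D₂ D₃ : List (List (MedialDart X))) (τ τ' : Option Bool), τ ≠ none ∧ τ' ≠ none ∧ τ ≠ τ' ∧
      IsTrace f (Function.update σ x τ) D₂ ∧ IsTrace f (Function.update σ x τ') D₃ ∧
      (-2 : ℤ) ^ D.length + (-2) ^ D₂.length + (-2) ^ D₃.length = 0 ∧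
      ∀ n, potential σ D (n + 1) + potential (Function.update σ x τ) D₂ n +
        potential (Function.update σ x τ') D₃ n = 0 := by
  obtain ⟨p, u, q, v, D', rfl, hq, ⟨h1, hl, hw⟩ | ⟨h1, hl, hw⟩⟩ := h.exists_strands hf hU x
  · obtain ⟨z, τ, τ', hτ, hτ', hne, hz, h2, h3⟩ := h1.exists_of_split hf hq.symm
    obtain ⟨y, z', hs, -⟩ := h1.exists_strandPair_of_split hq.symm
    rw [hx] at hτ hτ'
    set σ₀ := Function.update σ p.1.1 τ with hσ₀
    set σ₁ := Function.update σ p.1.1 τ' with hσ₁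
    have hE : crossSign σ₁ = crossSign σ₀ := crossSign_update hτ' hτ
    have h0 : σ₀ p.1.1 ≠ none := by simpa [hσ₀] using hτ
    have hσ : ∀ e ≠ p.1.1, σ e = σ₀ e := update_trace_eq σ _ _
    have hnull : ∀ d : MedialDart X, d.1.1 = p.1.1 → ∀ b, crossSign σ₀ d b = 0 := fun d hd =>
      crossSign_of_ne_none (by rwa [hd])
    have hν : ∀ a b, crossSign σ₀ (mate σ a) b = -crossSign σ₀ a b := crossSign_mate fun e he => by
      by_cases hep : e = p.1.1
      · rw [hep, hx]
      · rw [hσ e hep, he]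
    have key := h1.weight_join_add_weight_join_reverse hf hU hq.symm hν hσ
    -- The two whole curves have intersection number zero, and the crossing at the vertex itself
    -- contributes `1` or `-1`.
    have hc : cross (crossSign σ₀) u v ^ 2 = 1 := by
      have h4 := hU _ _ _ _ h1
      rw [cross_cons_left, sum1, cross_cons_right,
        sum1_congr fun b hb => crossSign_of_vertex_ne (Ne.symm (hs.ne_right b hb)),
        sum1_congr fun b hb => crossSign_of_vertex_ne (by rw [hq]; exact hs.ne_left b hb),
        sum1_zero, sum1_zero, cross_congr fun a ha b _ =>
          crossSign_congr (σ' := σ₀) (by rw [hσ _ (hs.ne_left a ha)])] at h4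
      have h5 : cross (crossSign σ₀) u v = -crossSign σ p q := by linarith
      have hqp : p ≠ q := fun hh => by
        have := hs.half.nodup
        simp at this; grind
      rw [h5, neg_sq]
      exact crossSign_sq hq.symm hx (h1.snd_ne_of_crossing (by simp) (by simp) hq.symm hx hqp)
    have hwu := weight_of_single_visit (u := u) rfl hσ h0 hs.ne_left
    have hwv := weight_of_single_visit hq hσ h0 hs.ne_right
    have hD : totalWeight σ D' = totalWeight σ₀ D' :=
      totalWeight_congr fun b hb => by rw [hσ _ (hs.ne_rest b hb)]
    have hD₁ : totalWeight σ₁ D' = totalWeight σ₀ D' := by rw [totalWeight, hE]; rfl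
    have hj : weight (crossSign σ₀) (p :: u ++ q :: v) = weight (crossSign σ₀) (u ++ v) := by
      rw [weight_insert_null (crossSign_comm _) (hnull q hq), List.cons_append,
        ← List.nil_append (p :: _), weight_insert_null (crossSign_comm _) (hnull p rfl),
        List.nil_append]
    have hjr : weight (crossSign σ₁) (p :: u ++ z :: (v.map (mate σ)).reverse) =
        weight (crossSign σ₀) (u ++ (v.map (mate σ)).reverse) := by
      rw [hE, weight_insert_null (crossSign_comm _) (hnull z hz), List.cons_append,
        ← List.nil_append (p :: _), weight_insert_null (crossSign_comm _) (hnull p rfl),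
        List.nil_append]
    refine ⟨_, _, τ, τ', hτ, hτ', hne, h2, h3, ?_, fun n => ?_⟩
    · rw [hl]
      simp only [List.length_cons, pow_succ]; ring
    · unfold potential
      rw [hw, hl]
      rw [← hσ₀, ← hσ₁]
      simp only [totalWeight_cons, hwu, hwv, hD, hD₁, hj, hjr, List.length_cons, pow_succ]
      rw [hc] at key
      push_cast
      -- Both smoothings merge the two curves into one, so their powers of `-2` are equal and only
      -- the sum of the two joined weights enters.
      linear_combination (-6) * (-2) ^ D'.length * key
  · obtain ⟨z, τ, τ', hτ, hτ', hne, hz, h2, h3⟩ := h1.exists_of_join hf hq.symm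
    obtain ⟨y, z', hs, -⟩ := h1.exists_strandPair_of_join hq.symm
    rw [hx] at hτ hτ'
    set σ₀ := Function.update σ p.1.1 τ with hσ₀
    set σ₁ := Function.update σ p.1.1 τ' with hσ₁
    have hE : crossSign σ₁ = crossSign σ₀ := crossSign_update hτ' hτ
    have h0 : σ₀ p.1.1 ≠ none := by simpa [hσ₀] using hτ
    have hσ : ∀ e ≠ p.1.1, σ e = σ₀ e := update_trace_eq σ _ _
    have hnull : ∀ d : MedialDart X, d.1.1 = p.1.1 → ∀ b, crossSign σ₀ d b = 0 := fun d hd =>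
      crossSign_of_ne_none (by rwa [hd])
    have hν : ∀ a b, crossSign σ₀ (mate σ a) b = -crossSign σ₀ a b := crossSign_mate fun e he => by
      by_cases hep : e = p.1.1
      · rw [hep, hx]
      · rw [hσ e hep, he]
    have key := h2.weight_join_add_weight_join_reverse hf hU hq.symm hν fun _ _ => rfl
    -- One smoothing of a self-crossing makes the strands two different curves.
    have hc : cross (crossSign σ₀) u v = 0 := by
      have h4 := hU _ _ _ _ h2
      rw [cross_cons_left, cross_cons_right, sum1_congr fun b _ => hnull p rfl b,
        sum1_congr fun b _ => show crossSign σ₀ b q = 0 by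
          rw [crossSign_comm, hnull q hq, neg_zero], sum1_zero, sum1_zero, zero_add,
        zero_add] at h4
      exact h4
    have hqp : p ≠ q := fun hh => by
      have := hs.half.nodup
      simp at this; grind
    have hsq : crossSign σ p q ^ 2 = 1 :=
      crossSign_sq hq.symm hx (h1.snd_ne_of_crossing (by simp) (by simp) hq.symm hx hqp)
    have hcongr : ∀ a ∈ u ++ q :: v, ∀ b ∈ u ++ q :: v, crossSign σ a b = crossSign σ₀ a b := by
      have hmem : ∀ a ∈ u ++ q :: v, a.1.1 = p.1.1 → a = q := fun a ha hap => by
        rcases List.mem_append.1 ha with h | h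
        · exact absurd hap (hs.ne_left a h)
        · rcases List.mem_cons.1 h with h | h
          · exact h
          · exact absurd hap (hs.ne_right a h)
      intro a ha b hb
      by_cases hap : a.1.1 = p.1.1
      · by_cases hbp : b.1.1 = p.1.1
        · rw [hmem a ha hap, hmem b hb hbp, crossSign_self, crossSign_self]
        · rw [crossSign_of_vertex_ne (by rw [hap]; exact Ne.symm hbp),
            crossSign_of_vertex_ne (by rw [hap]; exact Ne.symm hbp)]
      · exact crossSign_congr (by rw [hσ _ hap])
    -- The self-crossing counts once among the squares, and it adds nothing to `quad` since the
    -- parts on its two sides are unlinked.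
    have hj : weight (crossSign σ) (p :: u ++ q :: v) = weight (crossSign σ₀) (u ++ v) + 1 := by
      rw [List.cons_append, weight, quad_cons, sum2, sum1_append, sum1,
        sum1_congr fun b hb => show crossSign σ p b ^ 2 = 0 by
          rw [crossSign_of_vertex_ne (Ne.symm (hs.ne_left b hb)), sq, zero_mul],
        sum1_congr fun b hb => show crossSign σ p b ^ 2 = 0 by
          rw [crossSign_of_vertex_ne (Ne.symm (hs.ne_right b hb)), sq, zero_mul],
        sum1_zero, sum1_zero, hsq,
        ← weight_insert_null (crossSign_comm _) (hnull q hq), ← weight_congr hcongr, weight]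
      · ring
      · intro w₁ k w₂ hw hk
        refine IsTrace.cross_eq_zero_of_join hf hU (p := p) (q := k) (D := D') ?_ hk
        rw [List.cons_append, ← hw]
        exact h1
    have hD : totalWeight σ D' = totalWeight σ₀ D' :=
      totalWeight_congr fun b hb => by rw [hσ _ (hs.ne_rest b hb)]
    have hD₁ : totalWeight σ₁ D' = totalWeight σ₀ D' := by rw [totalWeight, hE]; rfl
    have hwu : weight (crossSign σ₀) (p :: u) = weight (crossSign σ₀) u := by
      rw [← List.nil_append (p :: u), weight_insert_null (crossSign_comm _) (hnull p rfl),
        List.nil_append]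
    have hwv : weight (crossSign σ₀) (q :: v) = weight (crossSign σ₀) v := by
      rw [← List.nil_append (q :: v), weight_insert_null (crossSign_comm _) (hnull q hq),
        List.nil_append]
    have hjr : weight (crossSign σ₁) (p :: u ++ z :: (v.map (mate σ)).reverse) =
        weight (crossSign σ₀) (u ++ (v.map (mate σ)).reverse) := by
      rw [hE, weight_insert_null (crossSign_comm _) (hnull z hz), List.cons_append,
        ← List.nil_append (p :: _), weight_insert_null (crossSign_comm _) (hnull p rfl),
        List.nil_append]
    refine ⟨_, _, τ, τ', hτ, hτ', hne, h2, h3, ?_, fun n => ?_⟩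
    · rw [hl]
      simp only [List.length_cons, pow_succ]; ring
    · unfold potential
      rw [hw, hl]
      rw [← hσ₀, ← hσ₁]
      simp only [totalWeight_cons, hwu, hwv, hD, hD₁, hj, hjr, List.length_cons, pow_succ]
      rw [hc] at key
      push_cast
      linear_combination (-6) * (-2) ^ D'.length * key

end StateSum

/-! ### The number of closed curves of a state -/

section Loops

variable {X : Type*} {f : MedialDart X → MedialDart X} {σ : X → Option Bool}
  {D : List (List (MedialDart X))}

/-- Two darts are related if they are the two halves of an edge or are joined at a vertex. -/
def DartRel (f : MedialDart X → MedialDart X) (σ : X → Option Bool) (a b : MedialDart X) : Prop :=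
  b = f a ∨ b = mate σ a

/-- The closed curves of a state, without a direction. -/
def Loop (f : MedialDart X → MedialDart X) (σ : X → Option Bool) : Type _ := Quot (DartRel f σ)

/-- The number of closed curves of a state. -/
noncomputable def numLoops (f : MedialDart X → MedialDart X) (σ : X → Option Bool) : ℕ :=
  Nat.card (Loop f σ)

theorem IsWalk.quot_eq {p z : MedialDart X} {w : List (MedialDart X)} (h : IsWalk f σ p w z) :
    ∀ a ∈ p :: w, Quot.mk (DartRel f σ) a = Quot.mk _ p := by
  induction w generalizing p with
  | nil => simp
  | cons b w ih =>
    have hb : Quot.mk (DartRel f σ) b = Quot.mk _ p := by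
      rw [h.1]
      exact ((Quot.sound (.inl rfl) : Quot.mk (DartRel f σ) p = Quot.mk _ (f p)).trans
        (Quot.sound (.inr rfl))).symm
    intro a ha
    rcases List.mem_cons.1 ha with rfl | ha
    · rfl
    · rw [ih h.2 a ha, hb]

/-- A trace involves choices of directions and basepoints; this makes its length depend on the state
alone. -/
theorem IsTrace.length_eq (hf : ∀ d, f (f d) = d) (h : IsTrace f σ D) :
    D.length = numLoops f σ := by
  have hne : ∀ w ∈ D, w ≠ [] := by
    rintro w hw rfl
    exact h.closed _ hw
  let φ : Fin D.length → Loop f σ := fun i => Quot.mk _ (D[i].head (hne _ (List.getElem_mem _)))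
  have hmem : ∀ w ∈ D, ∀ hw : w ≠ [], ∀ a ∈ w,
      Quot.mk (DartRel f σ) a = Quot.mk _ (w.head hw) := by
    intro w hwD hw a ha
    cases w with
    | nil => exact absurd rfl hw
    | cons p w =>
      obtain ⟨z, hz, -⟩ := h.closed _ hwD
      exact hz.quot_eq a ha
  have hφ : Function.Bijective φ := by
    refine ⟨fun i j hij => ?_, fun c => ?_⟩
    -- Lying on the `i`-th curve in either direction is invariant under both involutions, so it is a
    -- property of the undirected loop.
    · let P : Loop f σ → Prop := Quot.lift (fun d => d ∈ D[i] ∨ f d ∈ D[i]) (by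
        intro a b hab
        have hcl := h.closed D[i] (List.getElem_mem _)
        have key : ∀ a, a ∈ D[i] ∨ f a ∈ D[i] → mate σ a ∈ D[i] ∨ f (mate σ a) ∈ D[i] := by
          rintro a (ha | ha)
          · obtain ⟨c, hc, rfl⟩ := hcl.exists_pred ha
            right
            rwa [mate_mate, hf]
          · left
            have := hcl.succ_mem ha
            rwa [hf] at this
        rcases hab with rfl | rfl
        · simp only [hf, or_comm]
        · refine propext ⟨key a, fun h => ?_⟩
          have := key _ h
          rwa [mate_mate] at this)
      have hP : P (φ j) := by
        rw [← hij]
        exact Or.inl (List.head_mem _)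
      have hj : D[j].head (hne _ (List.getElem_mem _)) ∈ D[j] := List.head_mem _
      rcases (show D[j].head _ ∈ D[i] ∨ f (D[j].head _) ∈ D[i] from hP) with h1 | h1
      · by_contra hne'
        have hd := (List.nodup_flatten.1 h.half.nodup).2
        rw [List.pairwise_iff_getElem] at hd
        rcases lt_or_gt_of_ne (fun hh => hne' (Fin.ext hh) : i.1 ≠ j.1) with hlt | hlt
        · exact hd i j i.2 j.2 hlt h1 hj
        · exact hd j i j.2 i.2 hlt hj h1
      · exact absurd (List.mem_flatten.2 ⟨_, List.getElem_mem _, h1⟩)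
          (h.half.not_mem _ (List.mem_flatten.2 ⟨_, List.getElem_mem _, hj⟩))
    · induction c using Quot.ind with | _ d =>
      rcases h.half.mem_or d with hd | hd
      · obtain ⟨w, hw, hdw⟩ := List.mem_flatten.1 hd
        obtain ⟨i, hi, rfl⟩ := List.getElem_of_mem hw
        exact ⟨⟨i, hi⟩, (hmem _ hw _ d hdw).symm⟩
      · obtain ⟨w, hw, hdw⟩ := List.mem_flatten.1 hd
        obtain ⟨i, hi, rfl⟩ := List.getElem_of_mem hw
        refine ⟨⟨i, hi⟩, (hmem _ hw _ _ hdw).symm.trans ?_⟩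
        exact (Quot.sound (.inl rfl) : Quot.mk (DartRel f σ) d = Quot.mk _ (f d)).symm
  rw [numLoops, ← Nat.card_eq_of_bijective φ hφ, Nat.card_fin]

end Loops

/-! ### Tracing the curves of a state -/

section Existence

variable {X : Type*} {f : MedialDart X → MedialDart X} {σ : X → Option Bool}

/-- One step along the curves of a state, from an outgoing dart to the next one. -/
def step (f : MedialDart X → MedialDart X) (σ : X → Option Bool) (d : MedialDart X) :
    MedialDart X := mate σ (f d)

theorem step_injective (hf : ∀ d, f (f d) = d) : Function.Injective (step f σ) := by
  intro a b h
  have h1 : f a = f b := by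
    rw [← mate_mate σ (f a), ← mate_mate σ (f b)]
    exact congrArg _ h
  rw [← hf a, h1, hf]

theorem step_flip_step (hf : ∀ d, f (f d) = d) (d : MedialDart X) :
    step f σ (f (step f σ d)) = f d := by
  simp [step, hf]

/-- Conjugation by `f` inverts `step`: going on, turning round and going on equally far leads back.
-/
theorem iterate_step_flip (hf : ∀ d, f (f d) = d) (n : ℕ) (d : MedialDart X) :
    (step f σ)^[n] (f ((step f σ)^[n] d)) = f d := by
  induction n with
  | zero => rfl
  | succ n ih =>
    rw [Function.iterate_succ_apply, Function.iterate_succ_apply', step_flip_step hf, ih]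

/-- A curve never returns along its own edge in the opposite direction. Otherwise, halfway, it would
turn round within an edge (`n` even) or at a vertex (`n` odd), giving a fixed point of `f` or of
`mate σ`. -/
theorem iterate_step_ne_flip (hf : ∀ d, f (f d) = d) (hne : ∀ d, f d ≠ d) (n : ℕ)
    (d : MedialDart X) : (step f σ)^[n] d ≠ f d := by
  intro h
  have hinj : ∀ k, Function.Injective (step f σ)^[k] := (step_injective hf).iterate
  obtain ⟨k, rfl | rfl⟩ := Nat.even_or_odd' n
  · rw [two_mul, Function.iterate_add_apply, ← iterate_step_flip hf k d] at h
    exact hne _ (hinj k h).symm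
  · rw [two_mul, add_assoc, Function.iterate_add_apply, ← iterate_step_flip hf k d] at h
    have h1 := hinj k h
    rw [Function.iterate_succ_apply'] at h1
    exact mate_ne σ _ h1

/-- The outgoing darts of the curve through a given dart, starting with this dart. -/
noncomputable def orbitList (f : MedialDart X → MedialDart X) (σ : X → Option Bool) (d : MedialDart X) :
    List (MedialDart X) :=
  (List.range (Function.minimalPeriod (step f σ) d)).map fun i => (step f σ)^[i] d

theorem orbitList_nodup (d : MedialDart X) : (orbitList f σ d).Nodup :=
  Function.nodup_periodicOrbit

theorem isWalk_iterate (d : MedialDart X) (n : ℕ) :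
    IsWalk f σ d ((List.range n).map fun i => (step f σ)^[i + 1] d) (f ((step f σ)^[n] d)) := by
  induction n with
  | zero => rfl
  | succ n ih =>
    rw [List.range_succ, List.map_append]
    refine isWalk_append.2 ⟨_, ih, ?_, rfl⟩
    exact Function.iterate_succ_apply' _ _ _

variable [Finite X]

theorem minimalPeriod_step_pos (hf : ∀ d, f (f d) = d) (d : MedialDart X) :
    0 < Function.minimalPeriod (step f σ) d :=
  Function.minimalPeriod_pos_of_mem_periodicPts ((step_injective hf).mem_periodicPts d)

theorem mem_orbitList (hf : ∀ d, f (f d) = d) (d e : MedialDart X) :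
    e ∈ orbitList f σ d ↔ ∃ n, (step f σ)^[n] d = e :=
  Function.mem_periodicOrbit_iff ((step_injective hf).mem_periodicPts d)

theorem isClosedWalk_orbitList (hf : ∀ d, f (f d) = d) (d : MedialDart X) :
    IsClosedWalk f σ (orbitList f σ d) := by
  obtain ⟨n, hn⟩ := Nat.exists_eq_add_of_lt (minimalPeriod_step_pos (σ := σ) hf d)
  rw [zero_add] at hn
  have hper := Function.isPeriodicPt_minimalPeriod (step f σ) d
  unfold orbitList
  rw [hn] at hper ⊢
  rw [List.range_succ_eq_map, List.map_cons, List.map_map]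
  refine ⟨_, isWalk_iterate d n, ?_⟩
  rw [Function.IsPeriodicPt, Function.IsFixedPt, Function.iterate_succ_apply'] at hper
  exact hper.symm

theorem orbitList_flip_not_mem (hf : ∀ d, f (f d) = d) (hne : ∀ d, f d ≠ d) {d e : MedialDart X}
    (h : e ∈ orbitList f σ d) : f e ∉ orbitList f σ d := by
  intro h'
  obtain ⟨n, rfl⟩ := (mem_orbitList hf d e).1 h
  obtain ⟨m, hm⟩ := (mem_orbitList hf d _).1 h'
  refine iterate_step_ne_flip hf hne (σ := σ) (n + m) d ?_
  rw [Function.iterate_add_apply, hm, iterate_step_flip hf]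

theorem exists_isTrace (hf : ∀ d, f (f d) = d) (hne : ∀ d, f d ≠ d) (σ : X → Option Bool) :
    ∃ D, IsTrace f σ D := by
  classical
  have := Fintype.ofFinite X
  -- `R` holds the darts not yet covered. It is closed under both involutions, and each round
  -- removes an orbit together with its reverse.
  have key : ∀ (n : ℕ) (R : Finset (MedialDart X)), R.card ≤ n → (∀ d ∈ R, f d ∈ R) →
      (∀ d ∈ R, mate σ d ∈ R) → ∃ D : List (List (MedialDart X)),
        (∀ w ∈ D, IsClosedWalk f σ w) ∧ D.flatten.Nodup ∧ (∀ d ∈ D.flatten, f d ∉ D.flatten) ∧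
          ∀ d, d ∈ R ↔ d ∈ D.flatten ∨ f d ∈ D.flatten := by
    intro n
    induction n with
    | zero =>
      intro R hR _ _
      have : R = ∅ := by simpa using hR
      exact ⟨[], by simp [this]⟩
    | succ n ih =>
      intro R hR hRf hRm
      rcases R.eq_empty_or_nonempty with rfl | ⟨d, hd⟩
      · exact ⟨[], by simp⟩
      set L := orbitList f σ d with hL
      have hcl : IsClosedWalk f σ L := isClosedWalk_orbitList hf d
      have hdL : d ∈ L := (mem_orbitList hf d d).2 ⟨0, rfl⟩
      have hLR : ∀ e ∈ L, e ∈ R := by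
        intro e he
        obtain ⟨n, rfl⟩ := (mem_orbitList hf d e).1 he
        clear he
        induction n with
        | zero => exact hd
        | succ n ih =>
          rw [Function.iterate_succ_apply']
          exact hRm _ (hRf _ ih)
      obtain ⟨D, h1, h2, h3, h4⟩ := ih (R.filter fun e => e ∉ L ∧ f e ∉ L) (by
          have : (R.filter fun e => e ∉ L ∧ f e ∉ L) ⊂ R :=
            Finset.filter_ssubset.2 ⟨d, hd, by simp [hdL]⟩
          have := Finset.card_lt_card this
          omega)
        (by
          intro e he
          simp only [Finset.mem_filter, hf] at he ⊢
          exact ⟨hRf e he.1, he.2.2, he.2.1⟩)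
        (by
          intro e he
          simp only [Finset.mem_filter] at he ⊢
          refine ⟨hRm e he.1, fun h => he.2.2 ?_, fun h => he.2.1 ?_⟩
          · obtain ⟨a, ha, hae⟩ := hcl.exists_pred h
            have : e = f a := by rw [← mate_mate σ e, hae, mate_mate]
            rwa [this, hf]
          · have := hcl.succ_mem h
            rwa [hf, mate_mate] at this)
      simp only [Finset.mem_filter] at h4
      refine ⟨L :: D, ?_, ?_, ?_, ?_⟩
      · simp only [List.mem_cons, forall_eq_or_imp]
        exact ⟨hcl, h1⟩
      · rw [List.flatten_cons, List.nodup_append]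
        refine ⟨orbitList_nodup d, h2, ?_⟩
        rintro a ha b hb rfl
        exact ((h4 a).2 (.inl hb)).2.1 ha
      · intro e he
        rw [List.flatten_cons, List.mem_append] at he ⊢
        rintro (h | h) <;> rcases he with he | he
        · exact orbitList_flip_not_mem hf hne he h
        · exact ((h4 e).2 (.inl he)).2.2 h
        · exact ((h4 e).2 (.inr h)).2.1 he
        · exact h3 e he h
      · intro e
        rw [List.flatten_cons, List.mem_append, List.mem_append]
        constructor
        · intro he
          by_cases h : e ∉ L ∧ f e ∉ L
          · have := (h4 e).1 ⟨he, h⟩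
            tauto
          · tauto
        · rintro ((h | h) | (h | h))
          · exact hLR e h
          · exact ((h4 e).2 (.inl h)).1
          · have := hRf _ (hLR _ h)
            rwa [hf] at this
          · exact ((h4 e).2 (.inr h)).1
  obtain ⟨D, h1, h2, h3, h4⟩ := key _ Finset.univ le_rfl (by simp) (by simp)
  exact ⟨D, h1, h2, fun d => (h4 d).1 (Finset.mem_univ d), h3⟩

end Existence

/-! ### The sum over all smoothings -/

section StateSumFormula

variable {X : Type*} [Fintype X] {f : MedialDart X → MedialDart X} {σ : X → Option Bool}
  {D : List (List (MedialDart X))}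

/-- The number of closed curves of the state in which the edges in `S` are kept and the others are
cut. -/
noncomputable def stateLoops (f : MedialDart X → MedialDart X) (S : X → Bool) : ℕ :=
  numLoops f fun e => some (S e)

open Classical in
/-- The ways to smooth all crossings of a state. -/
noncomputable def smoothings (σ : X → Option Bool) : Finset (X → Bool) :=
  Finset.univ.filter fun S => ∀ e, σ e = none ∨ σ e = some (S e)

open Classical in
theorem sum_smoothings (φ : (X → Bool) → ℤ) {x : X} (hx : σ x = none) {τ τ' : Option Bool}
    (h : τ ≠ none) (h' : τ' ≠ none) (hne : τ ≠ τ') :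
    ∑ S ∈ smoothings σ, φ S = ∑ S ∈ smoothings (Function.update σ x τ), φ S +
      ∑ S ∈ smoothings (Function.update σ x τ'), φ S := by
  obtain ⟨b, rfl⟩ := Option.ne_none_iff_exists'.1 h
  obtain ⟨b', rfl⟩ := Option.ne_none_iff_exists'.1 h'
  have hb : b' = !b := by cases b <;> cases b' <;> simp_all
  rw [← Finset.sum_filter_add_sum_filter_not (smoothings σ) fun S => S x = b]
  have key : ∀ c : Bool, smoothings (Function.update σ x (some c)) =
      (smoothings σ).filter fun S => S x = c := by
    intro c
    ext S
    simp only [smoothings, Finset.mem_filter, Finset.mem_univ, true_and]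
    constructor
    · intro h
      refine ⟨fun e => ?_, ?_⟩
      · by_cases he : e = x
        · left; rw [he, hx]
        · simpa [he] using h e
      · have := h x
        simpa [eq_comm] using this
    · rintro ⟨h, rfl⟩ e
      by_cases he : e = x
      · subst he; simp
      · simpa [he] using h e
  rw [key, key]
  congr 1
  refine Finset.sum_congr ?_ fun _ _ => rfl
  ext S
  simp [hb, Bool.eq_not]

/-- Any state has the same value as the signed sum over its smoothings. -/
theorem IsTrace.state_sum (hf : ∀ d, f (f d) = d) (hU : Unlinked f) (h : IsTrace f σ D) {n : ℕ}
    (hn : Nat.card {e // σ e = none} = n) :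
    (-2 : ℤ) ^ D.length = (-1) ^ n * ∑ S ∈ smoothings σ, (-2) ^ stateLoops f S ∧
      potential σ D n =
        (-1) ^ n * ∑ S ∈ smoothings σ, (-2 : ℤ) ^ stateLoops f S * (2 * stateLoops f S) := by
  classical
  induction n generalizing σ D with
  | zero =>
    have h0 : ∀ e, σ e ≠ none := fun e he => by
      have := (Finite.card_eq_zero_iff.1 hn)
      exact this.elim ⟨e, he⟩
    choose S hS using fun e => Option.ne_none_iff_exists'.1 (h0 e)
    obtain rfl : σ = fun e => some (S e) := funext hS
    have h1 : smoothings (fun e => some (S e)) = {S} := by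
      ext S'
      simp [smoothings, funext_iff, eq_comm]
    -- Without crossings all signs vanish, so only the term `2 * c` of the potential is left.
    have h2 : totalWeight (fun e => some (S e)) D = 0 := by
      have : weight (crossSign fun e => some (S e)) = fun _ => 0 := by
        funext w
        induction w with
        | nil => rfl
        | cons a w ih =>
          rw [← List.nil_append (a :: w), weight_insert_null (crossSign_comm _)
            (crossSign_of_ne_none (by simp)), List.nil_append, ih]
      rw [totalWeight, this]
      simp
    rw [h1, potential, h2, h.length_eq hf]
    simp [stateLoops]
  | succ n ih =>
    obtain ⟨x, hx⟩ : ∃ x, σ x = none := by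
      by_contra hh
      push Not at hh
      have : IsEmpty {e // σ e = none} := ⟨fun e => hh e e.2⟩
      simp at hn
    obtain ⟨D₂, D₃, τ, τ', hτ, hτ', hne, h2, h3, h4, h5⟩ := h.exists_smoothings hf hU hx
    have hcard : ∀ τ : Option Bool, τ ≠ none →
        Nat.card {e // Function.update σ x τ e = none} = n := by
      intro τ hτ
      rw [Nat.card_eq_fintype_card, Fintype.card_subtype] at hn ⊢
      have : (Finset.univ.filter fun e => Function.update σ x τ e = none) =
          (Finset.univ.filter fun e => σ e = none).erase x := by
        ext e
        by_cases he : e = x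
        · subst he; simp [hτ]
        · simp [he]
      rw [this, Finset.card_erase_of_mem (by simp [hx]), hn]
      rfl
    obtain ⟨a1, a2⟩ := ih h2 (hcard τ hτ)
    obtain ⟨b1, b2⟩ := ih h3 (hcard τ' hτ')
    rw [sum_smoothings _ hx hτ hτ' hne, sum_smoothings _ hx hτ hτ' hne]
    have h6 := h5 n
    rw [a2, b2] at h6
    rw [a1, b1] at h4
    push_cast
    rw [pow_succ]
    exact ⟨by linear_combination h4, by linear_combination h6⟩

end StateSumFormula

/-! ### Planarity -/

section Heights

variable {X : Type*} {f : MedialDart X → MedialDart X} {σ : X → Option Bool}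

/-- The rotation around the vertices of the medial graph. -/
def medialRot : MedialDart X → MedialDart X
  | (d, true) => (d, false)
  | (d, false) => ((d.1, !d.2), true)

/-- The property that every integral flow on the medial graph is the difference of a height function
on the faces; the height of a dart is the one of the face to its right. -/
def HasHeights (f : MedialDart X → MedialDart X) : Prop :=
  ∀ m : MedialDart X → ℚ, (∀ a, m (f a) = -m a) →
    (∀ a, m a + m (medialRot a) + m (medialRot (medialRot a)) +
      m (medialRot (medialRot (medialRot a))) = 0) →
    ∃ h : MedialDart X → ℚ, (∀ a, h (f a) = h a + m a) ∧ ∀ a, h (medialRot a) = h a + m a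

theorem IsWalk.exists_height {p z : MedialDart X} {w : List (MedialDart X)}
    (hw : IsWalk f σ p w z) {h : MedialDart X → ℚ} {g : MedialDart X → ℤ}
    (H : ∀ a ∈ p :: w, h (mate σ (f a)) = h a - g (mate σ (f a))) :
    ∃ l ∈ p :: w, f l = z ∧ h l = h p - sum1 g w := by
  induction w generalizing p with
  | nil => exact ⟨p, by simp, hw, by simp [sum1]⟩
  | cons b w ih =>
    obtain ⟨l, hl, hlz, e⟩ := ih hw.2 fun a ha => H a (.tail _ ha)
    refine ⟨l, .tail _ hl, hlz, ?_⟩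
    rw [e, sum1]
    have := H p (.head _)
    rw [← hw.1] at this
    rw [this]; push_cast; ring

/-- The height drops by `g` at each visit and has its initial value again after one round. -/
theorem IsClosedWalk.sum1_eq_zero {w : List (MedialDart X)} (hw : IsClosedWalk f σ w)
    {h : MedialDart X → ℚ} {g : MedialDart X → ℤ}
    (H : ∀ a ∈ w, h (mate σ (f a)) = h a - g (mate σ (f a))) : sum1 g w = 0 := by
  cases w with
  | nil => rfl
  | cons p w =>
    obtain ⟨z, hw, hz⟩ := hw
    obtain ⟨l, hl, hlz, e⟩ := hw.exists_height H
    have h1 := H l hl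
    rw [hlz, ← hz, e] at h1
    have : ((sum1 g (p :: w) : ℤ) : ℚ) = 0 := by
      rw [sum1]; push_cast; linarith
    exact_mod_cast this

theorem sum1_indicator {α : Type*} [DecidableEq α] (x : α) {w : List α} (hw : w.Nodup) :
    sum1 (fun u => if u = x then 1 else 0) w = if x ∈ w then 1 else 0 := by
  induction w with
  | nil => simp [sum1]
  | cons a w ih =>
    rw [List.nodup_cons] at hw
    simp only [sum1, ih hw.2, List.mem_cons]
    by_cases h : a = x
    · subst h; simp [hw.1]
    · simp [h, Ne.symm h]

-- Only the two neighbours of `b` in the rotation belong to the crossing strand; leaving along the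
-- next one means crossing `b` from right to left.
open Classical in
theorem crossSign_eq_indicator {b : MedialDart X} (hσ : σ b.1.1 = none) (u : MedialDart X) :
    crossSign σ u b = (if u = medialRot b then 1 else 0) +
      -1 * (if u = medialRot (medialRot (medialRot b)) then 1 else 0) := by
  rcases u with ⟨⟨e, s⟩, t⟩
  rcases b with ⟨⟨e', s'⟩, t'⟩
  by_cases he : e = e'
  · subst he
    rw [crossSign, if_pos ⟨rfl, hσ⟩]
    cases s <;> cases t <;> cases s' <;> cases t' <;> simp [medialRot, endSign]
  · rw [crossSign_of_vertex_ne (by exact he)]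
    cases t' <;> simp [medialRot, he]

theorem medialRot_four (c : MedialDart X) :
    medialRot (medialRot (medialRot (medialRot c))) = c := by
  rcases c with ⟨⟨e, s⟩, _ | _⟩ <;> simp [medialRot]

theorem medialRot_fst_fst (c : MedialDart X) : (medialRot c).1.1 = c.1.1 := by
  rcases c with ⟨⟨e, s⟩, _ | _⟩ <;> rfl

theorem mateOf_none_eq (c : MedialDart X) : mateOf none c = medialRot (medialRot c) := by
  rcases c with ⟨⟨e, s⟩, _ | _⟩ <;> rfl

theorem mateOf_some_eq (b : Bool) (c : MedialDart X) :
    mateOf (some b) c = medialRot c ∨ medialRot (mateOf (some b) c) = c := by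
  rcases c with ⟨⟨e, s⟩, _ | _⟩ <;> cases b <;> simp [mateOf, medialRot]

/-- The unit current along `U` is a flow, so it has heights. Along `V` the height on the right-hand
side changes exactly by the signs of the crossings with `U`, and it returns to its initial value. -/
theorem unlinked_of_hasHeights (hf : ∀ d, f (f d) = d) (hh : HasHeights f) : Unlinked f := by
  classical
  intro σ U V D hD
  have hU := hD.closed U (.head _)
  have hV := hD.closed V (.tail _ (.head _))
  have hn := hD.half.nodup
  have hUn : U.Nodup := by
    rw [List.flatten_cons, List.nodup_append] at hn
    exact hn.1
  have hVU : ∀ a ∈ V, a ∉ U := by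
    rw [List.flatten_cons, List.nodup_append] at hn
    exact fun a ha ha' => hn.2.2 a ha' a (by simp [ha]) rfl
  have hVU' : ∀ a ∈ V, f a ∉ U := fun a ha ha' => hD.half.not_mem a (by simp [ha]) (by simp [ha'])
  have hfU : ∀ a, f a ∈ U ↔ mate σ a ∈ U := by
    intro a
    constructor
    · intro h
      have := hU.succ_mem h
      rwa [hf] at this
    · intro h
      obtain ⟨c, hc, hca⟩ := hU.exists_pred h
      have : a = f c := by rw [← mate_mate σ a, hca, mate_mate]
      rwa [this, hf]
  -- The current is `1` on the darts along which `U` leaves a vertex and `-1` on those through which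
  -- it arrives.
  let m : MedialDart X → ℚ := fun a => (if a ∈ U then 1 else 0) - if mate σ a ∈ U then 1 else 0
  have hm : ∀ a, m a = (if a ∈ U then 1 else 0) - if mate σ a ∈ U then 1 else 0 := fun _ => rfl
  obtain ⟨h, h1, h2⟩ := hh m (by
      intro a
      simp only [hm, ← hfU, hf]
      ring) (by
      rintro ⟨⟨e, s⟩, t⟩
      cases s <;> cases t <;> rcases hσ : σ e with _ | _ | _ <;>
        simp [hm, medialRot, mate, mateOf, hσ] <;> ring)
  rw [cross, sum1_comm]
  refine hV.sum1_eq_zero (h := h) fun a ha => ?_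
  have hb : mate σ (f a) ∈ V := hV.succ_mem ha
  have hmc : m (f a) = 0 := by
    rw [hm, if_neg (hVU' a ha), if_neg (hVU _ hb), sub_zero]
  have hmb : m (mate σ (f a)) = 0 := by
    rw [hm, if_neg (hVU _ hb), mate_mate, if_neg (hVU' a ha), sub_zero]
  -- The face to the right of `a` is the one to the left of `f a`, so it is also to the right of the
  -- dart after `f a`.
  have ha' : h a = h (medialRot (f a)) := by
    rw [h2, ← h1, hf]
  rw [ha']
  generalize f a = c at hb hmc hmb
  rcases hσ : σ c.1.1 with _ | b
  -- At a crossing, the right-hand side of `V` passes over the dart `medialRot c`, whose current is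
  -- the crossing sign.
  · have hb' : mate σ c = medialRot (medialRot c) := by rw [mate, hσ, mateOf_none_eq]
    rw [show (fun u => crossSign σ u (mate σ c)) = _ from
      funext fun u => crossSign_eq_indicator (b := mate σ c) (by simpa using hσ) u, sum1_add,
      sum1_mul_left, sum1_indicator _ hUn, sum1_indicator _ hUn]
    have e1 : medialRot (medialRot (medialRot (mate σ c))) = medialRot c := by
      rw [hb', medialRot_four]
    have e2 : medialRot (mate σ c) = mate σ (medialRot c) := by
      rw [hb', mate, medialRot_fst_fst, hσ, mateOf_none_eq]
    rw [e1, e2, hb', h2 (medialRot c), hm]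
    push_cast
    ring
  · have h0 : sum1 (fun u => crossSign σ u (mate σ c)) U = 0 := by
      rw [sum1_congr fun u _ => show crossSign σ u (mate σ c) = 0 by
        rw [crossSign_comm, crossSign_of_ne_none (by simp [hσ]), neg_zero], sum1_zero]
    rw [h0, Int.cast_zero, sub_zero]
    -- At a smoothing `V` turns into a neighbouring dart, and only darts without current are passed.
    have : mate σ c = medialRot c ∨ medialRot (mate σ c) = c := by
      rw [mate, hσ]
      exact mateOf_some_eq b c
    rcases this with hc | hc
    · rw [hc]
    · have := h2 (mate σ c)
      rw [hc, hmb, add_zero] at this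
      rw [h2, hmc, add_zero, this]

end Heights

/-! ### Flows and heights from Euler's formula -/

section Euler

variable {V E : Type*} {G : Graph V E}

theorem Graph.IsConnected.induction (hG : G.IsConnected) {Q : V → Prop} {x : V}
    (hx : x ∈ G.vertexSet) (hQ : Q x) (h : ∀ e a b, G.IsLink e a b → Q a → Q b) :
    ∀ y ∈ G.vertexSet, Q y := by
  intro y hy
  have := hG.2 x hx y hy
  induction this with
  | refl => exact hQ
  | tail h1 h2 ih =>
    obtain ⟨e, he⟩ := h2
    exact h e _ _ he (ih he.left_mem)

namespace PlanarEmbedding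

variable (P : PlanarEmbedding G)

theorem base_mem (d : G.edgeSet × Bool) : P.base d ∈ G.vertexSet := by
  rcases d with ⟨e, _ | _⟩
  · exact (P.isLink e).left_mem
  · exact (P.isLink e).right_mem

theorem isLink_base (d : G.edgeSet × Bool) : G.IsLink d.1 (P.base d) (P.base (d.1, !d.2)) := by
  rcases d with ⟨e, _ | _⟩
  · exact P.isLink e
  · exact (P.isLink e).symm

theorem exists_base_of_isLink {e : E} {a b : V} (h : G.IsLink e a b) :
    ∃ d : G.edgeSet × Bool, d.1.1 = e ∧ P.base d = a ∧ P.base (d.1, !d.2) = b := by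
  rcases h.eq_and_eq_or_eq_and_eq (P.isLink ⟨e, h.edge_mem⟩) with ⟨h1, h2⟩ | ⟨h1, h2⟩
  · exact ⟨(⟨e, h.edge_mem⟩, false), rfl, h1.symm, h2.symm⟩
  · exact ⟨(⟨e, h.edge_mem⟩, true), rfl, h1.symm, h2.symm⟩

theorem base_rot (d : G.edgeSet × Bool) : P.base (P.rot d) = P.base d :=
  ((P.sameCycle_iff _ _).1 (Equiv.Perm.sameCycle_apply_right.2 (.refl _ _))).symm

/-- The vertex at which an edge end lies. -/
def vertexOf (d : G.edgeSet × Bool) : G.vertexSet := ⟨P.base d, P.base_mem d⟩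

/-- The face to the left of an edge end. -/
def leftFace (d : G.edgeSet × Bool) : P.toMap.Face :=
  -- `faceStep` has the face on its right, so the cycle of the flipped dart is taken.
  Quotient.mk (Equiv.Perm.SameCycle.setoid P.toMap.faceStep) (d.1, !d.2)

/-- Both sides are the face in the corner between `d` and `rot d`. -/
theorem leftFace_flip_rot (d : G.edgeSet × Bool) :
    P.leftFace ((P.rot d).1, !(P.rot d).2) = P.leftFace d := by
  refine Quotient.sound ?_
  change P.toMap.faceStep.SameCycle _ _
  have h1 : (((P.rot d).1, !(P.rot d).2).1, !((P.rot d).1, !(P.rot d).2).2) =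
      P.toMap.faceStep (d.1, !d.2) := by
    simp [CombMap.faceStep, toMap, swapEnds]
  rw [h1]
  exact Equiv.Perm.sameCycle_apply_left.2 (.refl _ _)

/-- The difference of a function on the vertices and a function on the faces, at the corners. -/
def cornerDiff : (G.vertexSet → ℚ) × (P.toMap.Face → ℚ) →ₗ[ℚ] (G.edgeSet × Bool → ℚ) where
  toFun a d := a.1 (P.vertexOf d) - a.2 (P.leftFace d)
  map_add' a b := by funext d; simp only [Prod.fst_add, Prod.snd_add, Pi.add_apply]; ring
  map_smul' c a := by
    funext d
    simp only [Prod.smul_fst, Prod.smul_snd, Pi.smul_apply, smul_eq_mul, RingHom.id_apply]; ring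

/-- The total flow out of the medial vertices, for a flow given on the corners. -/
def cornerFlow : (G.edgeSet × Bool → ℚ) →ₗ[ℚ] (G.edgeSet → ℚ) where
  toFun m e := m (e, true) - m (P.rot.symm (e, true)) + m (e, false) - m (P.rot.symm (e, false))
  map_add' a b := by funext d; simp only [Pi.add_apply]; ring
  map_smul' c a := by funext d; simp only [Pi.smul_apply, smul_eq_mul, RingHom.id_apply]; ring

theorem range_cornerDiff_le : LinearMap.range P.cornerDiff ≤ LinearMap.ker P.cornerFlow := by
  rintro _ ⟨a, rfl⟩
  rw [LinearMap.mem_ker]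
  funext e
  have hv : ∀ d, P.vertexOf (P.rot.symm d) = P.vertexOf d := fun d =>
    Subtype.ext (by simpa [vertexOf] using (P.base_rot (P.rot.symm d)).symm)
  have hl : ∀ d, P.leftFace (P.rot.symm d) = P.leftFace (d.1, !d.2) := fun d => by
    simpa using (P.leftFace_flip_rot (P.rot.symm d)).symm
  simp [cornerFlow, cornerDiff, hv, hl]

/-- In the kernel, the value at a vertex equals the value at each face around it. As both ends of an
edge share a face, connectedness makes everything constant, and one value determines all. -/
theorem finrank_ker_cornerDiff_le (hG : G.IsConnected) :
    Module.finrank ℚ (LinearMap.ker P.cornerDiff) ≤ 1 := by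
  obtain ⟨x, hx⟩ := hG.1
  let ev : LinearMap.ker P.cornerDiff →ₗ[ℚ] ℚ :=
    (LinearMap.proj ⟨x, hx⟩ ∘ₗ LinearMap.fst ℚ (G.vertexSet → ℚ) (P.toMap.Face → ℚ)) ∘ₗ
      (LinearMap.ker P.cornerDiff).subtype
  have hev : Function.Injective ev := by
    rw [← LinearMap.ker_eq_bot, LinearMap.ker_eq_bot']
    rintro ⟨⟨a, b⟩, hab⟩ h0
    have h0 : a ⟨x, hx⟩ = 0 := h0
    have hab' : ∀ d, a (P.vertexOf d) = b (P.leftFace d) := fun d => by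
      have := congrFun (LinearMap.mem_ker.1 hab) d
      simpa [cornerDiff, sub_eq_zero] using this
    have hflip : ∀ d, a (P.vertexOf (d.1, !d.2)) = a (P.vertexOf d) := fun d => by
      have h1 := P.leftFace_flip_rot (P.rot.symm d)
      have h2 := P.base_rot (P.rot.symm d)
      simp only [Equiv.apply_symm_apply] at h1 h2
      have h3 : P.vertexOf d = P.vertexOf (P.rot.symm d) := Subtype.ext h2
      rw [hab', h1, ← hab', ← h3]
    have ha : ∀ y (hy : y ∈ G.vertexSet), a ⟨y, hy⟩ = 0 := by
      have := hG.induction (Q := fun y => ∀ hy : y ∈ G.vertexSet, a ⟨y, hy⟩ = 0) hx (fun _ => h0) (by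
        intro e y z he h1 hz
        obtain ⟨d, rfl, rfl, rfl⟩ := P.exists_base_of_isLink he
        exact (hflip d).trans (h1 (P.base_mem d)))
      exact fun y hy => this y hy hy
    have hb : b = 0 := by
      funext φ
      induction φ using Quotient.ind with | _ d =>
      have := hab' (d.1, !d.2)
      rw [show P.vertexOf (d.1, !d.2) = ⟨_, P.base_mem _⟩ from rfl, ha] at this
      have h1 : b ⟦d⟧ = 0 := by simpa [leftFace] using this.symm
      exact h1
    have ha' : a = 0 := funext fun y => ha y.1 y.2
    simp [ha', hb]
  simpa using LinearMap.finrank_le_finrank_of_injective hev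

theorem medial_flip_flip (d : MedialDart G.edgeSet) : P.medial.flip (P.medial.flip d) = d :=
  P.medial.flip_flip d

variable [Fintype G.edgeSet]

-- A unit flow on the corner between `d` and `rot d` is sent to the difference of their two edges.
-- By connectedness the range contains all differences of edges, so it has codimension at most one.
open Classical in
theorem finrank_range_cornerFlow_ge (hG : G.IsConnected) :
    Fintype.card G.edgeSet ≤ Module.finrank ℚ (LinearMap.range P.cornerFlow) + 1 := by
  rcases isEmpty_or_nonempty G.edgeSet with hE | ⟨⟨e₀⟩⟩
  · simp
  let W := LinearMap.range P.cornerFlow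
  let s : G.edgeSet → G.edgeSet → ℚ := fun e => Pi.single e 1
  have hrot : ∀ d, s d.1 - s (P.rot d).1 ∈ W := by
    intro d
    refine ⟨Pi.single d 1, ?_⟩
    have hps : ∀ c : G.edgeSet × Bool, P.rot.symm c = d ↔ c = P.rot d := fun c =>
      P.rot.symm_apply_eq
    funext e
    have h1 : (Pi.single d (1 : ℚ) : G.edgeSet × Bool → ℚ) (e, true) +
        (Pi.single d (1 : ℚ) : G.edgeSet × Bool → ℚ) (e, false) = s d.1 e := by
      rcases d with ⟨e', _ | _⟩ <;> simp [s, Pi.single_apply]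
    have h2 : (Pi.single d (1 : ℚ) : G.edgeSet × Bool → ℚ) (P.rot.symm (e, true)) +
        (Pi.single d (1 : ℚ) : G.edgeSet × Bool → ℚ) (P.rot.symm (e, false)) =
          s (P.rot d).1 e := by
      simp only [Pi.single_apply, hps, s]
      rcases P.rot d with ⟨e', _ | _⟩ <;> simp
    simp only [cornerFlow, LinearMap.coe_mk, AddHom.coe_mk, Pi.sub_apply, ← h1, ← h2]
    ring
  have hcyc : ∀ d d', P.base d = P.base d' → s d.1 - s d'.1 ∈ W := by
    intro d d' h
    obtain ⟨n, rfl⟩ := ((P.sameCycle_iff d d').2 h).exists_nat_pow_eq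
    clear h
    induction n with
    | zero => simp
    | succ n ih =>
      have := W.add_mem ih (hrot ((P.rot ^ n) d))
      rw [pow_succ', Equiv.Perm.mul_apply]
      simpa using this
  have hall : ∀ y ∈ G.vertexSet, ∃ d, P.base d = y ∧ s d.1 - s e₀ ∈ W := by
    refine hG.induction (P.base_mem (e₀, true)) ⟨(e₀, true), rfl, by simp⟩ ?_
    rintro e a b he ⟨d, rfl, hd⟩
    obtain ⟨c, rfl, hc, rfl⟩ := P.exists_base_of_isLink he
    exact ⟨(c.1, !c.2), rfl, by simpa using W.add_mem (hcyc c d hc) hd⟩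
  have hs : ∀ e, s e - s e₀ ∈ W := by
    intro e
    obtain ⟨d, hd, h⟩ := hall _ (P.base_mem (e, true))
    simpa using W.add_mem (hcyc (e, true) d hd.symm) h
  have htop : W ⊔ Submodule.span ℚ {s e₀} = ⊤ := by
    rw [eq_top_iff]
    intro y _
    have : y = ∑ e, y e • s e := by
      funext e'
      simp [s, Finset.sum_apply, Pi.single_apply]
    rw [this]
    refine Submodule.sum_mem _ fun e _ => Submodule.smul_mem _ _ ?_
    have h1 := Submodule.add_mem _ (Submodule.mem_sup_left (T := Submodule.span ℚ {s e₀}) (hs e))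
      (Submodule.mem_sup_right (S := W) (Submodule.mem_span_singleton_self (s e₀)))
    simpa using h1
  have h1 := Submodule.finrank_add_le_finrank_add_finrank W (Submodule.span ℚ {s e₀})
  rw [htop, finrank_top, Module.finrank_fintype_fun_eq_card] at h1
  have h2 : Module.finrank ℚ (Submodule.span ℚ {s e₀}) ≤ 1 := finrank_span_le_card _ |>.trans (by simp)
  exact h1.trans (Nat.add_le_add_left h2 _)

/-- A dimension count: Euler's formula gives the range dimension at least `V + F - 1 = E + 1`, and
the kernel has dimension at most `2 * E - (E - 1) = E + 1`. -/
theorem range_cornerDiff (hV : G.vertexSet.Finite) (hG : G.IsConnected) [Nonempty G.edgeSet] :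
    LinearMap.range P.cornerDiff = LinearMap.ker P.cornerFlow := by
  have := hV.fintype
  have : Finite P.toMap.Face := Quotient.finite _
  have := Fintype.ofFinite P.toMap.Face
  refine Submodule.eq_of_le_of_finrank_le P.range_cornerDiff_le ?_
  have h1 := P.cornerDiff.finrank_range_add_finrank_ker
  have h2 := P.cornerFlow.finrank_range_add_finrank_ker
  have h3 := P.finrank_ker_cornerDiff_le hG
  have h4 := P.finrank_range_cornerFlow_ge hG
  have h5 : G.vertexSet.ncard + P.toMap.numFaces = G.edgeSet.ncard + 2 := P.euler
  rw [CombMap.numFaces, if_neg (by simp), ← Nat.card_coe_set_eq, ← Nat.card_coe_set_eq,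
    Nat.card_eq_fintype_card, Nat.card_eq_fintype_card, Nat.card_eq_fintype_card] at h5
  rw [Module.finrank_prod, Module.finrank_fintype_fun_eq_card,
    Module.finrank_fintype_fun_eq_card] at h1
  rw [Module.finrank_fintype_fun_eq_card, Fintype.card_prod, Fintype.card_bool] at h2
  omega

theorem hasHeights (hV : G.vertexSet.Finite) (hG : G.IsConnected) [Nonempty G.edgeSet] :
    HasHeights P.medial.flip := by
  intro m hm hm'
  have hft : ∀ d, P.medial.flip (d, true) = (P.rot d, false) := fun _ => rfl
  have hff : ∀ d, P.medial.flip (d, false) = (P.rot.symm d, true) := fun _ => rfl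
  have hmf : ∀ d, m (d, false) = -m (P.rot.symm d, true) := fun d => by
    rw [← hff, hm, neg_neg]
  have hker : (fun d => m (d, true)) ∈ LinearMap.ker P.cornerFlow := by
    rw [LinearMap.mem_ker]
    funext e
    have := hm' ((e, true), true)
    simp only [medialRot, hmf, Bool.not_true] at this
    simp only [cornerFlow, LinearMap.coe_mk, AddHom.coe_mk, Pi.zero_apply]
    linarith
  rw [← P.range_cornerDiff hV hG] at hker
  obtain ⟨⟨a, b⟩, hab⟩ := hker
  have hab : ∀ d, a (P.vertexOf d) - b (P.leftFace d) = m (d, true) := fun d => congrFun hab d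
  have hrot : ∀ d, P.vertexOf (P.rot d) = P.vertexOf d := fun d => Subtype.ext (P.base_rot d)
  have hrot' : ∀ d, P.vertexOf (P.rot.symm d) = P.vertexOf d := fun d => by
    rw [← hrot, Equiv.apply_symm_apply]
  have hl : ∀ d, P.leftFace (P.rot.symm d) = P.leftFace (d.1, !d.2) := fun d => by
    simpa using (P.leftFace_flip_rot (P.rot.symm d)).symm
  -- The faces of the medial graph are the vertices and the faces of `P`. A dart `(d, true)` has the
  -- left face of `d` on its right, and `(d, false)` has the vertex of `d`.
  refine ⟨fun d => if d.2 then b (P.leftFace d.1) else a (P.vertexOf d.1), ?_, ?_⟩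
  · rintro ⟨d, _ | _⟩
    · simp [hff, hmf, ← hab, hrot']
    · simp [hft, hrot, ← hab]
  · rintro ⟨d, _ | _⟩
    · simp [medialRot, hmf, ← hab, hrot', hl]
    · simp [medialRot, ← hab]

theorem unlinked (hV : G.vertexSet.Finite) (hG : G.IsConnected) [Nonempty G.edgeSet] :
    Unlinked P.medial.flip :=
  unlinked_of_hasHeights P.medial_flip_flip (P.hasHeights hV hG)

end PlanarEmbedding

end Euler

/-! ### Counting the curves around a spanning subgraph -/

section SpanningSubgraphs

variable {V E : Type*} {G : Graph V E}

/-- Two vertices are related if they are joined by an edge in `S`. -/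
def Graph.JoinedBy (G : Graph V E) (S : G.edgeSet → Bool) (x y : G.vertexSet) : Prop :=
  ∃ e : G.edgeSet, S e = true ∧ G.IsLink e x y

/-- The connected components of the spanning subgraph with edge set `S`. -/
def Graph.Component (G : Graph V E) (S : G.edgeSet → Bool) : Type _ := Quot (G.JoinedBy S)

/-- The number of connected components of the spanning subgraph with edge set `S`. -/
noncomputable def Graph.numComponents (G : Graph V E) (S : G.edgeSet → Bool) : ℕ :=
  Nat.card (G.Component S)

namespace PlanarEmbedding

variable (P : PlanarEmbedding G)

theorem joinedBy_vertexOf {S : G.edgeSet → Bool} (d : G.edgeSet × Bool) (h : S d.1 = true) :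
    G.JoinedBy S (P.vertexOf d) (P.vertexOf (d.1, !d.2)) :=
  ⟨d.1, h, P.isLink_base d⟩

/-- The component of the spanning subgraph that is surrounded by a curve. -/
def componentOfLoop (S : G.edgeSet → Bool) :
    Loop P.medial.flip (fun e => some (S e)) → G.Component S :=
  Quot.lift (fun d => Quot.mk _ (P.vertexOf d.1)) (by
    rintro ⟨d, t⟩ b (rfl | rfl)
    · have hrot : ∀ d, P.vertexOf (P.rot d) = P.vertexOf d := fun d => Subtype.ext (P.base_rot d)
      cases t
      · change _ = Quot.mk _ (P.vertexOf (P.rot.symm d))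
        rw [← hrot (P.rot.symm d), Equiv.apply_symm_apply]
      · change _ = Quot.mk _ (P.vertexOf (P.rot d))
        rw [hrot]
    · rcases hS : S d.1 with _ | _
      · simp only [mate, mateOf, hS]
        rfl
      · simp only [mate, mateOf, hS]
        exact Quot.sound (P.joinedBy_vertexOf d hS))

open Classical in
/-- Adding an edge to a spanning subgraph removes at most one component. -/
theorem numComponents_le_add_one (P : PlanarEmbedding G) [Finite G.vertexSet] (S : G.edgeSet → Bool)
    (x : G.edgeSet) : G.numComponents S ≤ G.numComponents (Function.update S x true) + 1 := by
  set a : G.Component S := Quot.mk _ (P.vertexOf (x, false)) with ha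
  set b : G.Component S := Quot.mk _ (P.vertexOf (x, true)) with hb
  have : Finite (G.Component (Function.update S x true)) := Quot.finite _
  -- Redirecting `b` to `a` is compatible with the new edge, and `b` is the only component that may
  -- be missed; the extra point of the `Option` below supplies it.
  let c : G.Component S → G.Component S := fun y => if y = b then a else y
  let g : G.Component (Function.update S x true) → G.Component S :=
    Quot.lift (fun v => c (Quot.mk _ v)) (by
      rintro v w ⟨e, he, hl⟩
      by_cases hex : e = x
      · subst hex
        obtain ⟨h1, h2⟩ | ⟨h1, h2⟩ := hl.eq_and_eq_or_eq_and_eq (P.isLink e)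
        · rw [show v = P.vertexOf (e, false) from Subtype.ext h1,
            show w = P.vertexOf (e, true) from Subtype.ext h2, ← ha, ← hb]
          simp [c]
        · rw [show v = P.vertexOf (e, true) from Subtype.ext h1,
            show w = P.vertexOf (e, false) from Subtype.ext h2, ← ha, ← hb]
          simp [c]
      · rw [Function.update_of_ne hex] at he
        rw [(Quot.sound ⟨e, he, hl⟩ : Quot.mk (G.JoinedBy S) v = Quot.mk _ w)])
  have hsurj : Function.Surjective fun o : Option (G.Component (Function.update S x true)) =>
      o.elim b g := by
    intro y
    by_cases hy : y = b
    · exact ⟨none, hy.symm⟩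
    · induction y using Quot.ind with | _ v =>
      exact ⟨some (Quot.mk _ v), if_neg hy⟩
  have := Nat.card_le_card_of_surjective _ hsurj
  rwa [Finite.card_option] at this

open Classical in
/-- Adding an edge with both ends in one component does not change the number of components. -/
theorem numComponents_le [Finite G.vertexSet] {S : G.edgeSet → Bool} {x : G.edgeSet}
    (h : (Quot.mk _ (P.vertexOf (x, false)) : G.Component S) = Quot.mk _ (P.vertexOf (x, true))) :
    G.numComponents S ≤ G.numComponents (Function.update S x true) := by
  have : Finite (G.Component (Function.update S x true)) := Quot.finite _
  let g : G.Component (Function.update S x true) → G.Component S :=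
    Quot.lift (fun v => Quot.mk _ v) (by
      rintro v w ⟨e, he, hl⟩
      by_cases hex : e = x
      · subst hex
        obtain ⟨h1, h2⟩ | ⟨h1, h2⟩ := hl.eq_and_eq_or_eq_and_eq (P.isLink e)
        · rw [show v = P.vertexOf (e, false) from Subtype.ext h1,
            show w = P.vertexOf (e, true) from Subtype.ext h2]
          exact h
        · rw [show v = P.vertexOf (e, true) from Subtype.ext h1,
            show w = P.vertexOf (e, false) from Subtype.ext h2]
          exact h.symm
      · rw [Function.update_of_ne hex] at he
        exact Quot.sound ⟨e, he, hl⟩)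
  refine Nat.card_le_card_of_surjective g fun y => ?_
  induction y using Quot.ind with | _ v =>
  exact ⟨Quot.mk _ v, rfl⟩

variable [Fintype G.edgeSet]

/-- The amount by which the number of curves falls short of its value for a plane graph. -/
noncomputable def genusDefect (S : G.edgeSet → Bool) : ℤ :=
  2 * G.numComponents S + (Finset.univ.filter fun e => S e = true).card - G.vertexSet.ncard -
    stateLoops P.medial.flip S

-- If two curves run along the cut edge, keeping it merges them, while at most one component is
-- lost. If a single curve does, both ends of the edge already lie in one component, and at most one
-- curve is gained.
open Classical in
theorem genusDefect_le_update (hV : G.vertexSet.Finite) (hG : G.IsConnected) [Nonempty G.edgeSet]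
    {S : G.edgeSet → Bool} {x : G.edgeSet} (hx : S x = false) :
    P.genusDefect S ≤ P.genusDefect (Function.update S x true) := by
  have : Finite G.vertexSet := hV
  have hf := P.medial_flip_flip
  have hU := P.unlinked hV hG
  have hcard : (Finset.univ.filter fun e => Function.update S x true e = true).card =
      (Finset.univ.filter fun e => S e = true).card + 1 := by
    have : (Finset.univ.filter fun e => Function.update S x true e = true) =
        insert x (Finset.univ.filter fun e => S e = true) := by
      ext e
      by_cases he : e = x
      · subst he; simp
      · simp [he]
    rw [this, Finset.card_insert_of_notMem (by simp [hx])]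
  set S' := Function.update S x true
  have hupd : ∀ inst : DecidableEq G.edgeSet, @Function.update _ _ inst (fun e => some (S e)) x
      (some true) = fun e => some (S' e) := by
    intro inst
    funext e
    by_cases he : e = x
    · subst he; simp [S']
    · simp [S', he]
  obtain ⟨D, hD⟩ := exists_isTrace hf P.medial.flip_ne fun e => some (S e)
  have hl : stateLoops P.medial.flip S = D.length := (hD.length_eq hf).symm
  -- The cut edge uses the smoothing `some false`, so exactly one of the two other matchings is the
  -- smoothing that keeps it.
  have pick : ∀ τ τ' : Option Bool, τ ≠ some false → τ' ≠ some false → τ ≠ τ' → τ = some true ∨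
      τ' = some true := by decide
  have hlen : ∀ (D' : List (List (MedialDart G.edgeSet))) (σ : G.edgeSet → Option Bool),
      IsTrace P.medial.flip σ D' → (σ = fun e => some (S' e)) →
        stateLoops P.medial.flip S' = D'.length := fun D' σ h' hσ => by
    rw [h'.length_eq hf, stateLoops, hσ]
  have hk : G.numComponents S ≤ G.numComponents S' + 1 := P.numComponents_le_add_one S x
  unfold genusDefect
  obtain ⟨p, u, q, v, D', rfl, hq, ⟨h1, h2, -⟩ | ⟨h1, h2, -⟩⟩ := hD.exists_strands hf hU x
  · obtain ⟨z, τ, τ', hτ, hτ', hne, -, h3, h4⟩ := h1.exists_of_split hf hq.symm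
    simp only [hx] at hτ hτ'
    have hlen' : stateLoops P.medial.flip S' = D'.length + 1 := by
      rcases pick τ τ' hτ hτ' hne with rfl | rfl
      · exact hlen _ _ h3 (hupd _)
      · exact hlen _ _ h4 (hupd _)
    rw [hlen', hl, h2, hcard]
    push_cast
    omega
  · obtain ⟨z, τ, τ', hτ, hτ', hne, -, h3, h4⟩ := h1.exists_of_join hf hq.symm
    simp only [hx] at hτ hτ'
    have hlen' : stateLoops P.medial.flip S' ≤ D'.length + 2 := by
      rcases pick τ τ' hτ hτ' hne with rfl | rfl
      · rw [hlen _ _ h3 (hupd _)]; simp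
      · rw [hlen _ _ h4 (hupd _)]; simp
    have hk' : G.numComponents S ≤ G.numComponents S' := by
      refine P.numComponents_le ?_
      obtain ⟨z', hw, -⟩ := h1.closed _ (.head _)
      have h5 := congrArg (P.componentOfLoop S) (hw.quot_eq q (by simp))
      have h5 : (Quot.mk _ (P.vertexOf q.1) : G.Component S) = Quot.mk _ (P.vertexOf p.1) := h5
      have hn := h1.half.nodup
      have hqp : q ≠ p := by simp at hn; grind
      have hqp' : q ≠ mate (fun e => some (S e)) p := fun hh =>
        h1.mate_not_mem (d := p) (by simp) (by rw [← hh]; simp)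
      rcases p with ⟨⟨e, s⟩, t⟩
      rcases q with ⟨⟨e', s'⟩, t'⟩
      obtain rfl : e' = e := hq
      -- The cut state matches the two darts at the same end of the edge, so the two visits are at
      -- different ends.
      have hss : s ≠ s' := by
        rintro rfl
        simp only [mate, mateOf, hx] at hqp'
        cases t <;> cases t' <;> simp_all
      cases s <;> cases s'
      · exact absurd rfl hss
      · exact h5.symm
      · exact h5
      · exact absurd rfl hss
    rw [hl, h2, hcard]
    push_cast
    omega

/-- With all edges cut, each curve surrounds one vertex and is determined by it. -/
theorem genusDefect_false_nonneg (hV : G.vertexSet.Finite) :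
    0 ≤ P.genusDefect fun _ => false := by
  have : Finite G.vertexSet := hV
  have h1 : G.numComponents (fun _ => false) = G.vertexSet.ncard := by
    rw [← Nat.card_coe_set_eq]
    refine (Nat.card_eq_of_bijective (fun v : G.vertexSet => (Quot.mk _ v : G.Component _))
      ⟨fun v w h => ?_, fun c => ?_⟩).symm
    · have := congrArg (Quot.lift (fun v : G.vertexSet => v) (by
        rintro a b ⟨e, he, -⟩
        simp at he)) h
      exact this
    · induction c using Quot.ind with | _ v =>
      exact ⟨v, rfl⟩
  have h2 : stateLoops P.medial.flip (fun _ => false) ≤ G.numComponents fun _ => false := by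
    have : Finite (G.Component fun _ => false) := Quot.finite _
    refine Nat.card_le_card_of_injective (P.componentOfLoop _) fun a b hab => ?_
    induction a using Quot.ind with | _ a =>
    induction b using Quot.ind with | _ b =>
    have hab : (Quot.mk _ (P.vertexOf a.1) : G.Component fun _ => false) =
      Quot.mk _ (P.vertexOf b.1) := hab
    have := congrArg (Quot.lift (fun v : G.vertexSet => v) (by
        rintro a b ⟨e, he, -⟩
        simp at he)) hab
    have hbase : P.base a.1 = P.base b.1 := congrArg Subtype.val this
    obtain ⟨n, hn⟩ := ((P.sameCycle_iff _ _).2 hbase).exists_nat_pow_eq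
    have hside : ∀ d : G.edgeSet × Bool, ∀ t t',
        Quot.mk (DartRel P.medial.flip fun _ => some false) (d, t) = Quot.mk _ (d, t') := by
      have : ∀ d : G.edgeSet × Bool,
          Quot.mk (DartRel P.medial.flip fun _ => some false) (d, true) = Quot.mk _ (d, false) :=
        fun d => Quot.sound (.inr rfl)
      intro d t t'
      cases t <;> cases t'
      · rfl
      · exact (this d).symm
      · exact this d
      · rfl
    have hrot : ∀ n : ℕ, ∀ d : G.edgeSet × Bool,
        Quot.mk (DartRel P.medial.flip fun _ => some false) (d, true) =
          Quot.mk _ ((P.rot ^ n) d, true) := by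
      intro n d
      induction n with
      | zero => rfl
      | succ n ih =>
        rw [ih, pow_succ', Equiv.Perm.mul_apply, hside _ true false]
        rw [hside _ false true]
        exact (Quot.sound (.inl rfl) : Quot.mk (DartRel P.medial.flip fun _ => some false)
          ((P.rot ^ n) d, true) = Quot.mk _ (P.rot ((P.rot ^ n) d), false)).trans (hside _ _ _)
    rcases a with ⟨a, t⟩
    rcases b with ⟨b, t'⟩
    exact (hside a t true).trans ((hrot n a).trans (by rw [hn]; exact hside b true t'))
  have h3 : (Finset.univ.filter fun _ : G.edgeSet => false = true).card = 0 := by simp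
  unfold genusDefect
  rw [h3]
  push_cast
  omega

/-- With all edges kept there is one component and at least one curve for each face, and Euler's
formula gives the bound. -/
theorem genusDefect_true_nonpos (hV : G.vertexSet.Finite) (hG : G.IsConnected)
    [Nonempty G.edgeSet] : P.genusDefect (fun _ => true) ≤ 0 := by
  have : Finite G.vertexSet := hV
  have : Finite (G.Component fun _ => true) := Quot.finite _
  have h1 : G.numComponents (fun _ => true) ≤ 1 := by
    refine Finite.card_le_one_iff_subsingleton.2 ⟨fun a b => ?_⟩
    induction a using Quot.ind with | _ a =>
    induction b using Quot.ind with | _ b =>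
    have := hG.induction (Q := fun y => ∀ hy : y ∈ G.vertexSet,
      (Quot.mk _ a : G.Component fun _ => true) = Quot.mk _ ⟨y, hy⟩) a.2 (fun _ => rfl) (by
        intro e y z he h1 hz
        rw [h1 he.left_mem]
        exact Quot.sound ⟨⟨e, he.edge_mem⟩, rfl, he⟩)
    exact this b b.2 b.2
  have h2 : P.toMap.numFaces ≤ stateLoops P.medial.flip fun _ => true := by
    have hfin : Finite (Loop P.medial.flip fun _ => some true) := Quot.finite _
    rw [CombMap.numFaces, if_neg (by simp)]
    let g : (Loop P.medial.flip fun _ => some true) → P.toMap.Face :=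
      Quot.lift (fun d => P.leftFace (if d.2 then d.1 else P.rot.symm d.1)) (by
        have hl : ∀ d, P.leftFace (P.rot.symm (d.1, !d.2)) = P.leftFace d := fun d => by
          simpa using (P.leftFace_flip_rot (P.rot.symm (d.1, !d.2))).symm
        have hl' : ∀ d, P.leftFace (P.rot.symm d) = P.leftFace (d.1, !d.2) := fun d => by
          simpa using (P.leftFace_flip_rot (P.rot.symm d)).symm
        rintro ⟨d, t⟩ b (rfl | rfl)
        · cases t
          · rfl
          · change P.leftFace d = P.leftFace (P.rot.symm (P.rot d))
            rw [Equiv.symm_apply_apply]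
        · cases t
          · exact hl' d
          · exact (hl d).symm)
    refine Nat.card_le_card_of_surjective g fun φ => ?_
    induction φ using Quotient.ind with | _ d =>
    refine ⟨Quot.mk _ ((d.1, !d.2), true), ?_⟩
    change P.leftFace (d.1, !d.2) = _
    simp only [leftFace, Bool.not_not]
    rfl
  have h3 : G.vertexSet.ncard + P.toMap.numFaces = G.edgeSet.ncard + 2 := P.euler
  have h4 : (Finset.univ.filter fun _ : G.edgeSet => true = true).card = G.edgeSet.ncard := by
    rw [← Nat.card_coe_set_eq, Nat.card_eq_fintype_card]; simp
  unfold genusDefect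
  rw [h4]
  omega

/-- The number of curves of a smoothed state depends only on the abstract graph. -/
theorem stateLoops_eq (hV : G.vertexSet.Finite) (hG : G.IsConnected) [Nonempty G.edgeSet]
    (S : G.edgeSet → Bool) :
    (stateLoops P.medial.flip S : ℤ) = 2 * G.numComponents S +
      (Finset.univ.filter fun e => S e = true).card - G.vertexSet.ncard := by
  classical
  -- The defect grows with the set of kept edges, so it is squeezed between its values at the empty
  -- set and at the full set.
  have key : ∀ (T : Finset G.edgeSet) (S : G.edgeSet → Bool),
      P.genusDefect S ≤ P.genusDefect fun e => S e || decide (e ∈ T) := by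
    intro T S
    induction T using Finset.induction_on with
    | empty => simp
    | insert x T _ ih =>
      refine ih.trans ?_
      by_cases hx : (S x || decide (x ∈ T)) = true
      · refine le_of_eq (congrArg _ (funext fun e => ?_))
        by_cases he : e = x
        · subst he
          rw [hx]; simp
        · simp [he]
      · have := P.genusDefect_le_update hV hG (S := fun e => S e || decide (e ∈ T))
          (x := x) (by simpa using hx)
        refine this.trans (le_of_eq (congrArg _ (funext fun e => ?_)))
        by_cases he : e = x
        · subst he; simp
        · simp [he]
  have h1 := key (Finset.univ.filter fun e => S e = true) fun _ => false
  have h2 := key Finset.univ S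
  have h3 := P.genusDefect_false_nonneg hV
  have h4 := P.genusDefect_true_nonpos hV hG
  simp only [Finset.mem_filter, Finset.mem_univ, true_and, Bool.false_or, Bool.decide_eq_true,
    decide_true, Bool.or_true] at h1 h2
  have h5 : P.genusDefect S = 0 := le_antisymm (h2.trans h4) (h3.trans h1)
  unfold genusDefect at h5
  linarith

end PlanarEmbedding

end SpanningSubgraphs

/-! ### Ordered sums as sums over ranges of indices -/

section RangeSums

variable {α : Type*}

theorem sum1_range (g : α → ℤ) (c : ℕ → α) (n : ℕ) :
    sum1 g ((List.range n).map c) = ∑ i ∈ Finset.range n, g (c i) := by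
  induction n with
  | zero => rfl
  | succ n ih =>
    rw [List.range_succ, List.map_append, sum1_append, ih, Finset.sum_range_succ]
    simp [sum1]

theorem sum2_range (g : α → α → ℤ) (c : ℕ → α) (n : ℕ) :
    sum2 g ((List.range n).map c) =
      ∑ j ∈ Finset.range n, ∑ i ∈ Finset.range j, g (c i) (c j) := by
  induction n with
  | zero => rfl
  | succ n ih =>
    rw [List.range_succ, List.map_append, sum2_append, ih, Finset.sum_range_succ, ← sum1_range
      (fun a => g a (c n))]
    simp [sum1, sum2]

theorem sum3_range (g : α → α → α → ℤ) (c : ℕ → α) (n : ℕ) :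
    sum3 g ((List.range n).map c) = ∑ k ∈ Finset.range n, ∑ j ∈ Finset.range k,
      ∑ i ∈ Finset.range j, g (c i) (c j) (c k) := by
  induction n with
  | zero => rfl
  | succ n ih =>
    rw [List.range_succ, List.map_append, sum3_append, ih, Finset.sum_range_succ, ← sum2_range
      (fun a b => g a b (c n))]
    simp [sum1, sum2, sum3, sum1_zero]

theorem sum4_range (g : α → α → α → α → ℤ) (c : ℕ → α) (n : ℕ) :
    sum4 g ((List.range n).map c) = ∑ l ∈ Finset.range n, ∑ k ∈ Finset.range l,
      ∑ j ∈ Finset.range k, ∑ i ∈ Finset.range j, g (c i) (c j) (c k) (c l) := by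
  induction n with
  | zero => rfl
  | succ n ih =>
    have h2 (w : List α) : sum2 (fun _ _ : α => (0 : ℤ)) w = 0 := by
      simpa using sum2_mul_left 0 (fun _ _ : α => 0) w
    rw [List.range_succ, List.map_append, sum4_append, ih, Finset.sum_range_succ, ← sum3_range
      (fun a b d => g a b d (c n))]
    simp [sum1, sum2, sum3, sum4, sum1_zero, h2]

end RangeSums

/-! ### Unicursal medial graphs as traces with a single curve -/

section Curves

variable {V E : Type*} {G : Graph V E} (P : PlanarEmbedding G)

namespace PlanarEmbedding

theorem medial_rot_apply (d : MedialDart G.edgeSet) : P.medial.rot d = medialRot d := by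
  rcases d with ⟨⟨e, s⟩, _ | _⟩ <;> rfl

theorem medial_straight : ⇑P.medial.straight = step P.medial.flip fun _ => none := by
  funext d
  rw [step, mate, mateOf_none_eq, ← P.medial_rot_apply, ← P.medial_rot_apply]
  rfl

theorem medial_vert_eq_iff [Finite G.edgeSet] {a b : MedialDart G.edgeSet} :
    P.medial.vert a = P.medial.vert b ↔ a.1.1 = b.1.1 := by
  have hab : P.medial.vert a = P.medial.vert b ↔ P.medial.rot.SameCycle a b := Quotient.eq
  rw [hab]
  constructor
  · intro h
    obtain ⟨n, rfl⟩ := h.exists_nat_pow_eq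
    clear h hab
    induction n with
    | zero => rfl
    | succ n ih =>
      rw [pow_succ', Equiv.Perm.mul_apply, medial_rot_apply, medialRot_fst_fst, ← ih]
  · have h1 : ∀ d, P.medial.rot.SameCycle d (P.medial.rot d) := fun d =>
      Equiv.Perm.sameCycle_apply_right.2 (.refl _ _)
    have key : ∀ (e : G.edgeSet) (s t : Bool),
        P.medial.rot.SameCycle ((e, true), true) ((e, s), t) := by
      intro e s t
      have a1 := h1 ((e, true), true)
      have a2 := h1 ((e, true), false)
      have a3 := h1 ((e, false), true)
      rw [medial_rot_apply] at a1 a2 a3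
      cases s <;> cases t
      · exact a1.trans (a2.trans a3)
      · exact a1.trans a2
      · exact a1
      · exact .refl _ _
    rcases a with ⟨⟨e, s⟩, t⟩
    rcases b with ⟨⟨e', s'⟩, t'⟩
    rintro rfl
    exact (key e s t).symm.trans (key e s' t')

variable {P}

theorem isTrace_of_isSingleCurve [Finite G.edgeSet] (h : P.medial.IsSingleCurve)
    (b : MedialDart G.edgeSet) :
    IsTrace P.medial.flip (fun _ => none) [orbitList P.medial.flip (fun _ => none) b] := by
  have hf := P.medial_flip_flip
  have hmem : ∀ d, P.medial.straight.SameCycle b d →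
      d ∈ orbitList P.medial.flip (fun _ => none) b := by
    intro d hd
    obtain ⟨n, rfl⟩ := hd.exists_nat_pow_eq
    rw [mem_orbitList hf, ← medial_straight]
    exact ⟨n, by rw [Equiv.Perm.iterate_eq_pow]⟩
  refine ⟨?_, ?_, fun d => ?_, fun d hd => ?_⟩
  · simpa using isClosedWalk_orbitList hf b
  · simpa using orbitList_nodup b
  · simpa using (h b d).imp (hmem d) (hmem _)
  · simp only [List.flatten_cons, List.flatten_nil, List.append_nil] at hd ⊢
    exact orbitList_flip_not_mem hf P.medial.flip_ne hd

theorem sameCycle_of_isWalk {p z : MedialDart G.edgeSet} {w : List (MedialDart G.edgeSet)}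
    (h : IsWalk P.medial.flip (fun _ => none) p w z) :
    ∀ a ∈ p :: w, P.medial.straight.SameCycle p a := by
  induction w generalizing p with
  | nil =>
    intro a ha
    rw [List.mem_singleton.1 ha]
  | cons b w ih =>
    have hb : b = P.medial.straight p := by rw [medial_straight]; exact h.1
    intro a ha
    rcases List.mem_cons.1 ha with rfl | ha
    · exact .refl _ _
    · have := ih h.2 a ha
      rw [hb] at this
      exact Equiv.Perm.sameCycle_apply_left.1 this

theorem isSingleCurve_of_isTrace [Finite G.edgeSet] {w : List (MedialDart G.edgeSet)}
    (h : IsTrace P.medial.flip (fun _ => none) [w]) : P.medial.IsSingleCurve := by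
  have hf := P.medial_flip_flip
  have hw : ∀ a ∈ w, ∀ c ∈ w, P.medial.straight.SameCycle a c := by
    have := h.closed w (.head _)
    cases w with
    | nil => simp
    | cons p w =>
      obtain ⟨z, hz, -⟩ := this
      exact fun a ha c hc => (sameCycle_of_isWalk hz a ha).symm.trans (sameCycle_of_isWalk hz c hc)
  -- Straight steps from the flipped dart are steps backwards along the same curve.
  have hflip : ∀ a c, P.medial.straight.SameCycle (P.medial.flip a) c →
      P.medial.straight.SameCycle a (P.medial.flip c) := by
    intro a c hac
    obtain ⟨n, rfl⟩ := hac.exists_nat_pow_eq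
    have := iterate_step_flip (σ := fun _ => none) hf n (P.medial.flip a)
    rw [← medial_straight, Equiv.Perm.iterate_eq_pow, hf] at this
    refine Equiv.Perm.SameCycle.symm ⟨n, ?_⟩
    rw [zpow_natCast]
    exact this
  have hmem := h.half.mem_or
  simp only [List.flatten_cons, List.flatten_nil, List.append_nil] at hmem
  intro b d
  rcases hmem b with hb | hb <;> rcases hmem d with hd | hd
  · exact .inl (hw b hb d hd)
  · exact .inr (hw b hb _ hd)
  · exact .inr (hflip b d (hw _ hb d hd))
  · left
    have := hflip b _ (hw _ hb _ hd)
    rwa [hf] at this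

end PlanarEmbedding

end Curves

/-! ### The defect as an ordered sum over the visits -/

section Defect

variable {V E : Type*} {G : Graph V E} {P : PlanarEmbedding G}

theorem crossSign_eq_ite {X : Type*} [DecidableEq X] {σ : X → Option Bool} {a b : MedialDart X}
    (hab : a.1.1 = b.1.1) (h : a.2 ≠ b.2) (hσ : σ a.1.1 = none) :
    crossSign σ a b = if a = medialRot b then 1 else -1 := by
  rcases a with ⟨⟨e, s⟩, t⟩
  rcases b with ⟨⟨e', s'⟩, t'⟩
  obtain rfl : e = e' := hab
  rw [crossSign, if_pos ⟨rfl, hσ⟩]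
  cases s <;> cases t <;> cases s' <;> cases t' <;> simp_all [medialRot, endSign]

theorem CombMap.sgn_ne_zero {D : Type*} (M : CombMap D) (b : D) (x : M.Vertex) :
    M.sgn b x ≠ 0 := by
  unfold CombMap.sgn
  split_ifs <;> decide

namespace PlanarEmbedding

variable {b : MedialDart G.edgeSet}

theorem orbitList_eq (b : MedialDart G.edgeSet) : orbitList P.medial.flip (fun _ => none) b =
    (List.range (Function.minimalPeriod P.medial.straight b)).map (P.medial.curve b) := by
  rw [orbitList, ← medial_straight]
  rfl

theorem visits_of_lt {x : P.medial.Vertex}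
    (hx : P.medial.firstVisit b x < P.medial.secondVisit b x) :
    P.medial.firstVisit b x ∈ P.medial.visits b x ∧
      P.medial.secondVisit b x ∈ P.medial.visits b x := by
  have hne : (P.medial.visits b x).Nonempty := by
    -- On an empty set of visits both `sInf` and `sSup` default to `0`, which the strict inequality
    -- excludes.
    by_contra hh
    rw [Set.not_nonempty_iff_eq_empty] at hh
    simp [CombMap.firstVisit, CombMap.secondVisit, hh] at hx
  exact ⟨Nat.sInf_mem hne, Nat.sSup_mem hne ⟨_, fun i hi => hi.1.le⟩⟩

variable [Finite G.edgeSet]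

theorem curve_snd_ne (h : P.medial.IsSingleCurve) {i k : ℕ} (hik : i ≠ k)
    (hi : i < Function.minimalPeriod P.medial.straight b)
    (hk : k < Function.minimalPeriod P.medial.straight b)
    (hv : (P.medial.curve b i).1.1 = (P.medial.curve b k).1.1) :
    (P.medial.curve b i).2 ≠ (P.medial.curve b k).2 := by
  have hmem : ∀ j < Function.minimalPeriod P.medial.straight b, P.medial.curve b j ∈
      [orbitList P.medial.flip (fun _ => none) b].flatten := fun j hj => by
    simp only [orbitList_eq, List.flatten_cons, List.flatten_nil, List.append_nil, List.mem_map,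
      List.mem_range]
    exact ⟨j, hj, rfl⟩
  exact (isTrace_of_isSingleCurve h b).snd_ne_of_crossing (hmem i hi) (hmem k hk) hv rfl fun he =>
    hik ((Function.iterate_eq_iterate_iff_of_lt_minimalPeriod hi hk).1 he)

theorem visits_eq (h : P.medial.IsSingleCurve) {i k : ℕ} (hik : i < k)
    (hk : k < Function.minimalPeriod P.medial.straight b)
    (hv : (P.medial.curve b i).1.1 = (P.medial.curve b k).1.1) :
    P.medial.visits b (P.medial.vert (P.medial.curve b i)) = {i, k} := by
  ext j
  simp only [CombMap.visits, Set.mem_ofPred_eq, Set.mem_insert_iff, Set.mem_singleton_iff,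
    P.medial_vert_eq_iff]
  constructor
  · rintro ⟨hj, hji⟩
    -- A third visit would need a last bit different from two different bits.
    by_contra hne
    push Not at hne
    have h1 := curve_snd_ne h hik.ne (hik.trans hk) hk hv
    have h2 := curve_snd_ne h hne.1 hj (hik.trans hk) hji
    have h3 := curve_snd_ne h hne.2 hj hk (hji.trans hv)
    generalize (P.medial.curve b i).2 = x at h1 h2
    generalize (P.medial.curve b j).2 = y at h2 h3
    generalize (P.medial.curve b k).2 = z at h1 h3
    revert h1 h2 h3
    revert x y z
    decide
  · rintro (rfl | rfl)
    · exact ⟨hik.trans hk, rfl⟩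
    · exact ⟨hk, hv.symm⟩

theorem firstVisit_eq (h : P.medial.IsSingleCurve) {i k : ℕ} (hik : i < k)
    (hk : k < Function.minimalPeriod P.medial.straight b)
    (hv : (P.medial.curve b i).1.1 = (P.medial.curve b k).1.1) :
    P.medial.firstVisit b (P.medial.vert (P.medial.curve b i)) = i := by
  rw [CombMap.firstVisit, visits_eq h hik hk hv, csInf_pair, inf_eq_left.2 hik.le]

theorem secondVisit_eq (h : P.medial.IsSingleCurve) {i k : ℕ} (hik : i < k)
    (hk : k < Function.minimalPeriod P.medial.straight b)
    (hv : (P.medial.curve b i).1.1 = (P.medial.curve b k).1.1) :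
    P.medial.secondVisit b (P.medial.vert (P.medial.curve b i)) = k := by
  rw [CombMap.secondVisit, visits_eq h hik hk hv, csSup_pair, sup_eq_right.2 hik.le]

/-- The sign of a crossing in terms of the two visits. -/
theorem crossSign_visits (h : P.medial.IsSingleCurve) {x : P.medial.Vertex}
    (hx : P.medial.firstVisit b x < P.medial.secondVisit b x) :
    crossSign (fun _ => none) (P.medial.curve b (P.medial.firstVisit b x))
      (P.medial.curve b (P.medial.secondVisit b x)) = P.medial.sgn b x := by
  classical
  obtain ⟨⟨h1, h2⟩, h3, h4⟩ := visits_of_lt hx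
  have hv := P.medial_vert_eq_iff.1 (h2.trans h4.symm)
  rw [crossSign_eq_ite hv (curve_snd_ne h hx.ne h1 h3 hv) rfl, CombMap.sgn, ← medial_rot_apply]
  congr

/-- The nonzero terms of `quad` are quadruples of times `i < j < k < l` in which `i`, `k` visit one
vertex and `j`, `l` another, which are exactly the interleaved pairs. -/
theorem defect_eq (h : P.medial.IsSingleCurve) (b : MedialDart G.edgeSet) :
    P.medial.defect b =
      -2 * quad (crossSign fun _ => none) (orbitList P.medial.flip (fun _ => none) b) := by
  classical
  have hfin : Finite P.medial.Vertex := Quotient.finite _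
  rw [CombMap.defect, quad, orbitList_eq, sum4_range]
  congr 1
  have hI : {p : P.medial.Vertex × P.medial.Vertex | P.medial.Interleaved b p.1 p.2}.Finite :=
    Set.toFinite _
  have e1 : ∑ᶠ (p : P.medial.Vertex × P.medial.Vertex) (_ : P.medial.Interleaved b p.1 p.2),
      P.medial.sgn b p.1 * P.medial.sgn b p.2 =
      ∑ p ∈ hI.toFinset, P.medial.sgn b p.1 * P.medial.sgn b p.2 :=
    finsum_mem_eq_finite_toFinset_sum _ hI
  rw [e1]
  simp only [Finset.sum_sigma']
  refine Eq.trans ?_ (Finset.sum_filter_ne_zero _)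
  -- The times are listed from last to first, since in `sum4_range` the outermost index is the
  -- largest.
  refine Finset.sum_bij (fun p _ => ⟨P.medial.secondVisit b p.2, P.medial.secondVisit b p.1,
    P.medial.firstVisit b p.2, P.medial.firstVisit b p.1⟩) ?_ ?_ ?_ ?_
  · rintro ⟨x, y⟩ hp
    obtain ⟨h1, h2, h3⟩ : P.medial.Interleaved b x y := by simpa using hp
    have hx := h1.trans h2
    have hy := h2.trans h3
    simp only [Finset.mem_filter, Finset.mem_sigma, Finset.mem_range, crossSign_visits h hx,
      crossSign_visits h hy]
    exact ⟨⟨(visits_of_lt hy).2.1, h3, h2, h1⟩, mul_ne_zero (P.medial.sgn_ne_zero b x)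
      (P.medial.sgn_ne_zero b y)⟩
  · rintro ⟨x, y⟩ hp ⟨x', y'⟩ hp' he
    obtain ⟨h1, h2, h3⟩ : P.medial.Interleaved b x y := by simpa using hp
    obtain ⟨h1', h2', h3'⟩ : P.medial.Interleaved b x' y' := by simpa using hp'
    simp only [Sigma.mk.injEq, heq_eq_eq] at he
    obtain ⟨e1, e2, -, -⟩ := he
    have hx := (visits_of_lt (h1.trans h2)).2.2
    have hy := (visits_of_lt (h2.trans h3)).2.2
    rw [e2, (visits_of_lt (h1'.trans h2')).2.2] at hx
    rw [e1, (visits_of_lt (h2'.trans h3')).2.2] at hy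
    rw [hx, hy]
  · rintro ⟨l, k, j, i⟩ hm
    simp only [Finset.mem_filter, Finset.mem_sigma, Finset.mem_range] at hm
    obtain ⟨⟨hl, hk, hj, hi⟩, hne⟩ := hm
    have hx := (crossSign_ne_zero (left_ne_zero_of_mul hne)).1
    have hy := (crossSign_ne_zero (right_ne_zero_of_mul hne)).1
    refine ⟨(P.medial.vert (P.medial.curve b i), P.medial.vert (P.medial.curve b j)), ?_, ?_⟩
    · simp only [Set.Finite.mem_toFinset, Set.mem_ofPred_eq, CombMap.Interleaved,
        firstVisit_eq h (hi.trans hj) (hk.trans hl) hx, firstVisit_eq h (hj.trans hk) hl hy,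
        secondVisit_eq h (hi.trans hj) (hk.trans hl) hx, secondVisit_eq h (hj.trans hk) hl hy]
      exact ⟨hi, hj, hk⟩
    · simp only [firstVisit_eq h (hi.trans hj) (hk.trans hl) hx,
        firstVisit_eq h (hj.trans hk) hl hy, secondVisit_eq h (hi.trans hj) (hk.trans hl) hx,
        secondVisit_eq h (hj.trans hk) hl hy]
  · rintro ⟨x, y⟩ hp
    obtain ⟨h1, h2, h3⟩ : P.medial.Interleaved b x y := by simpa using hp
    simp only [crossSign_visits h (h1.trans h2), crossSign_visits h (h2.trans h3)]

/-- A single curve crosses itself once at each medial vertex. -/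
theorem sum2_crossSign_sq (h : P.medial.IsSingleCurve) (b : MedialDart G.edgeSet) :
    sum2 (fun x y => crossSign (fun _ => none) x y ^ 2)
      (orbitList P.medial.flip (fun _ => none) b) = Nat.card G.edgeSet := by
  classical
  have := Fintype.ofFinite G.edgeSet
  have htr := isTrace_of_isSingleCurve h b
  rw [orbitList_eq, sum2_range, Nat.card_eq_fintype_card, Fintype.card, Finset.card_eq_sum_ones,
    Nat.cast_sum, Finset.sum_sigma', ← Finset.sum_filter_ne_zero]
  refine Finset.sum_bij (fun p _ => (P.medial.curve b p.2).1.1) ?_ ?_ ?_ ?_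
  · simp
  · rintro ⟨k, i⟩ hm ⟨k', i'⟩ hm' (he : (P.medial.curve b i).1.1 = (P.medial.curve b i').1.1)
    simp only [Finset.mem_filter, Finset.mem_sigma, Finset.mem_range] at hm hm'
    have hx := (crossSign_ne_zero (pow_ne_zero_iff two_ne_zero |>.1 hm.2)).1
    have hx' := (crossSign_ne_zero (pow_ne_zero_iff two_ne_zero |>.1 hm'.2)).1
    have hv := P.medial_vert_eq_iff.2 he
    have h1 := firstVisit_eq h hm.1.2 hm.1.1 hx
    have h2 := secondVisit_eq h hm.1.2 hm.1.1 hx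
    rw [hv, firstVisit_eq h hm'.1.2 hm'.1.1 hx'] at h1
    rw [hv, secondVisit_eq h hm'.1.2 hm'.1.1 hx'] at h2
    rw [h1, h2]
  · intro e _
    -- At a crossing mates share the last bit, so for either bit one of the two darts with that bit
    -- is outgoing.
    have hex : ∀ t, ∃ i < Function.minimalPeriod P.medial.straight b,
        (P.medial.curve b i).1.1 = e ∧ (P.medial.curve b i).2 = t := by
      intro t
      have := htr.mem_or_mate_mem P.medial_flip_flip ((e, true), t)
      simp only [orbitList_eq, List.flatten_cons, List.flatten_nil, List.append_nil, List.mem_map,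
        List.mem_range] at this
      rcases this with ⟨i, hi, hd⟩ | ⟨i, hi, hd⟩ <;> exact ⟨i, hi, by simp [hd, mate, mateOf]⟩
    obtain ⟨i, hi, hie, hit⟩ := hex true
    obtain ⟨k, hk, hke, hkt⟩ := hex false
    have hsq : ∀ x y : MedialDart G.edgeSet, x.1.1 = y.1.1 → x.2 ≠ y.2 →
        crossSign (fun _ => none) x y ^ 2 ≠ 0 := fun x y hxy hne => by
      rw [crossSign_sq hxy rfl hne]; exact one_ne_zero
    rcases lt_trichotomy i k with hik | rfl | hik
    · refine ⟨⟨k, i⟩, ?_, hie⟩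
      simp only [Finset.mem_filter, Finset.mem_sigma, Finset.mem_range]
      exact ⟨⟨hk, hik⟩, hsq _ _ (hie.trans hke.symm) (by simp [hit, hkt])⟩
    · simp [hit] at hkt
    · refine ⟨⟨i, k⟩, ?_, hke⟩
      simp only [Finset.mem_filter, Finset.mem_sigma, Finset.mem_range]
      exact ⟨⟨hi, hik⟩, hsq _ _ (hke.trans hie.symm) (by simp [hit, hkt])⟩
  · rintro ⟨k, i⟩ hm
    simp only [Finset.mem_filter, Finset.mem_sigma, Finset.mem_range] at hm
    obtain ⟨hx, hs, ht⟩ := crossSign_ne_zero (pow_ne_zero_iff two_ne_zero |>.1 hm.2)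
    simpa using crossSign_sq hx hs ht

end PlanarEmbedding

end Defect

/-! ### Independence of the embedding -/

theorem mainTheorem3 {V E : Type*} (G : Graph V E) (hV : G.vertexSet.Finite)
    (hE : G.edgeSet.Finite) (hconn : G.IsConnected) (P Q : PlanarEmbedding G)
    (hP : P.Unicursal) :
    Q.Unicursal ∧ ∀ b c, P.medial.defect b = Q.medial.defect c := by
  rcases isEmpty_or_nonempty G.edgeSet with hemp | ⟨⟨e⟩⟩
  -- Without edges the medial map has no darts, so there is no starting dart to consider.
  · exact ⟨fun b => isEmptyElim b.1.1, fun b => isEmptyElim b.1.1⟩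
  have := hE.fintype
  have : Nonempty G.edgeSet := ⟨e⟩
  have hL : ∀ S, stateLoops P.medial.flip S = stateLoops Q.medial.flip S := fun S => by
    have := (P.stateLoops_eq hV hconn S).trans (Q.stateLoops_eq hV hconn S).symm
    exact_mod_cast this
  have hn : Nat.card {e : G.edgeSet // (none : Option Bool) = none} = Nat.card G.edgeSet :=
    Nat.card_congr (Equiv.subtypeUnivEquiv fun _ => rfl)
  have hsum : ∀ {R R' : List (List (MedialDart G.edgeSet))},
      IsTrace P.medial.flip (fun _ => none) R → IsTrace Q.medial.flip (fun _ => none) R' →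
      (-2 : ℤ) ^ R.length = (-2) ^ R'.length ∧
        potential (fun _ => none) R (Nat.card G.edgeSet) =
          potential (fun _ => none) R' (Nat.card G.edgeSet) := fun hR hR' => by
    have h1 := hR.state_sum P.medial_flip_flip (P.unlinked hV hconn) hn
    have h2 := hR'.state_sum Q.medial_flip_flip (Q.unlinked hV hconn) hn
    simp only [hL] at h1
    exact ⟨h1.1.trans h2.1.symm, h1.2.trans h2.2.symm⟩
  have hQ : Q.medial.IsSingleCurve := by
    obtain ⟨R, hR⟩ := exists_isTrace Q.medial_flip_flip Q.medial.flip_ne fun _ => none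
    have h1 := (hsum (PlanarEmbedding.isTrace_of_isSingleCurve hP ((e, true), true)) hR).1
    -- The absolute value `2 ^ c` already determines the number `c` of curves.
    have h2 := congrArg Int.natAbs h1
    simp only [Int.natAbs_pow] at h2
    have h3 := Nat.pow_right_injective le_rfl h2
    obtain ⟨w, rfl⟩ := List.length_eq_one_iff.1 h3.symm
    exact PlanarEmbedding.isSingleCurve_of_isTrace hR
  refine ⟨hQ, fun b c => ?_⟩
  have h1 := (hsum (PlanarEmbedding.isTrace_of_isSingleCurve hP b)
    (PlanarEmbedding.isTrace_of_isSingleCurve hQ c)).2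
  -- With one curve and `n` crossings the potential is `-2 * (2 + n + 3 * (n + 4 * quad))`, which
  -- determines `quad`.
  simp only [potential, totalWeight, weight, List.map_cons, List.map_nil, List.sum_cons,
    List.sum_nil, List.length_cons, List.length_nil, zero_add, pow_one, PlanarEmbedding.sum2_crossSign_sq hP b,
    PlanarEmbedding.sum2_crossSign_sq hQ c] at h1
  rw [PlanarEmbedding.defect_eq hP, PlanarEmbedding.defect_eq hQ]
  rw [show quad (crossSign fun _ => none) (orbitList P.medial.flip (fun _ => none) b) =
    quad (crossSign fun _ => none) (orbitList Q.medial.flip (fun _ => none) c) by linarith]
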